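/- Let $M$ be a compact connected smooth surface without boundary, with a smooth area form $\omega$ (so $M$ is orientable) normalized by $\int_M\omega=1$, and let $r\in\{1,2,\dots,\infty\}$. Let $\mathrm{Diff}^r_\omega(M)$ be the set of $C^r$ diffeomorphisms $f$ of $M$ with $f^*\omega=\omega$, with the $C^r$ topology. Fix closed oriented curves $a_1,b_1,\dots,a_g,b_g$ of class $C^1$ whose classes form a basis of $H_1(M,\mathbb{Z})$ (for instance canonical generators, $g$ being the genus). If $f\in\mathrm{Diff}^r_\omega(M)$ is homotopic to the identity, the flux of $f$ across a closed curve $l$ is $F_f(l)=\int_D\omega \bmod 1\in\mathbb{R}/\mathbb{Z}$, where $D$ is any 2-chain of class $C^1$ with $\partial D=f(l)-l$, and the flux vector of $f$ is $\mathbf{v}_f=(F_f(a_1),F_f(b_1),\dots,F_f(a_g),F_f(b_g))\in\mathbb{T}^{2g}$. Let $f\in\mathrm{Diff}^r_\omega(M)$ be homotopic to the identity. Then for every neighbourhood $V$ of $f$ in $\mathrm{Diff}^r_\omega(M)$ there is a map $h\in V$, homotopic to the identity, such that all components of its flux vector $\mathbf{v}_h$ are rational (modulo $1$). -/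

import Mathlib

open scoped Manifold ContDiff Topology ENNReal

noncomputable section

namespace SurfaceFlux

/-- The Euclidean plane, the model space of surfaces. -/
abbrev Plane : Type := EuclideanSpace ℝ (Fin 2)

section Forms

variable (M : Type*) [TopologicalSpace M] [ChartedSpace Plane M] [IsManifold (𝓡 2) ∞ M]

/-- A smooth area form on the surface `M`: a smooth section of the bundle of bilinear forms on
tangent spaces that is alternating and nondegenerate at every point. A surface that carries an
area form is orientable. -/
structure AreaForm where
  toFun (x : M) : TangentSpace (𝓡 2) x →L[ℝ] TangentSpace (𝓡 2) x →L[ℝ] ℝ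
  alternating (x : M) (v : TangentSpace (𝓡 2) x) : toFun x v v = 0
  nondegenerate (x : M) (v : TangentSpace (𝓡 2) x) (hv : v ≠ 0) : ∃ w, toFun x v w ≠ 0
  contMDiff : ContMDiff (𝓡 2) ((𝓡 2).prod 𝓘(ℝ, Plane →L[ℝ] Plane →L[ℝ] ℝ)) ∞
    (fun x ↦ Bundle.TotalSpace.mk' (Plane →L[ℝ] Plane →L[ℝ] ℝ)
      (E := fun x : M ↦ TangentSpace (𝓡 2) x →L[ℝ] TangentSpace (𝓡 2) x →L[ℝ] ℝ) x (toFun x))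

variable {M}

/-- The coefficient of `Ω` in the preferred chart at `x`, as a function of the coordinates `y`:
`Ω = ± areaDensity Ω x dy₀ ∧ dy₁`. -/
def areaDensity (Ω : AreaForm M) (x : M) (y : Plane) : ℝ≥0∞ :=
  ‖Ω.toFun ((chartAt Plane x).symm y)
    (mfderiv (𝓡 2) (𝓡 2) (chartAt Plane x).symm y (EuclideanSpace.single 0 (1 : ℝ)))
    (mfderiv (𝓡 2) (𝓡 2) (chartAt Plane x).symm y (EuclideanSpace.single 1 (1 : ℝ)))‖ₑ

/-- The total area `∫_M Ω` (for the orientation given by `Ω`): the infimum, over the countable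
covers of `M` by sets each of which lies in the domain of a chart, of the sum of the areas of
the pieces, each computed in its chart. (The infimum is attained at every cover by pairwise
disjoint measurable pieces.) -/
def totalArea (Ω : AreaForm M) : ℝ≥0∞ :=
  ⨅ (x : ℕ → M) (s : ℕ → Set M) (_ : ⋃ i, s i = Set.univ)
    (_ : ∀ i, s i ⊆ (chartAt Plane (x i)).source),
    ∑' i, ∫⁻ y in chartAt Plane (x i) '' s i, areaDensity Ω (x i) y

end Forms

section Diffeomorphisms

variable {M : Type*} [TopologicalSpace M] [ChartedSpace Plane M] [IsManifold (𝓡 2) ∞ M]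

/-- `Diff^r_Ω(M)`: the `C^r` diffeomorphisms `f` of `M` with `f^* Ω = Ω`. -/
def AreaDiffeo (Ω : AreaForm M) (r : ℕ∞) : Type _ :=
  {f : Diffeomorph (𝓡 2) (𝓡 2) M M r //
    ∀ (x : M) (v w : TangentSpace (𝓡 2) x),
      Ω.toFun (f x) (mfderiv (𝓡 2) (𝓡 2) f x v) (mfderiv (𝓡 2) (𝓡 2) f x w) = Ω.toFun x v w}

/-- The underlying continuous map. -/
def AreaDiffeo.toContinuousMap {Ω : AreaForm M} {r : ℕ∞} (f : AreaDiffeo Ω r) : C(M, M) :=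
  ⟨f.1, f.1.continuous⟩

/-- The map `f` read in the preferred charts at `x` (source) and `y` (target). -/
def inCharts {Ω : AreaForm M} {r : ℕ∞} (f : AreaDiffeo Ω r) (x y : M) : Plane → Plane :=
  chartAt Plane y ∘ f.1 ∘ (chartAt Plane x).symm

/-- The basic neighbourhood of `f` given by the charts at `x` and `y`, a set `K`, an order `k`
and `ε`: all `h` that map `K` into the domain of the chart at `y` and whose derivatives of
order at most `k`, read in the charts, are `ε`-close to those of `f` on `K`. -/
def basicNhd {Ω : AreaForm M} {r : ℕ∞} (f : AreaDiffeo Ω r) (x y : M) (K : Set M) (k : ℕ)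
    (ε : ℝ) : Set (AreaDiffeo Ω r) :=
  {h | Set.MapsTo h.1 K (chartAt Plane y).source ∧
    ∀ p ∈ K, ∀ j ≤ k,
      ‖iteratedFDeriv ℝ j (inCharts h x y) (chartAt Plane x p)
        - iteratedFDeriv ℝ j (inCharts f x y) (chartAt Plane x p)‖ < ε}

/-- The `C^r` topology on `Diff^r_Ω(M)` (`M` compact): uniform convergence in charts, on
compact sets, of all derivatives of finite order at most `r`. -/
instance (Ω : AreaForm M) (r : ℕ∞) : TopologicalSpace (AreaDiffeo Ω r) :=
  TopologicalSpace.generateFrom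
    {N | ∃ (f : AreaDiffeo Ω r) (x y : M) (K : Set M) (k : ℕ) (ε : ℝ),
      IsCompact K ∧ K ⊆ (chartAt Plane x).source ∧
      Set.MapsTo f.1 K (chartAt Plane y).source ∧ (k : ℕ∞) ≤ r ∧ 0 < ε ∧
      N = basicNhd f x y K k ε}

end Diffeomorphisms

section Chains

/-- The standard triangle in `ℝ²`, with vertices `(0,0)`, `(1,0)`, `(0,1)`. -/
def triangle : Set (ℝ × ℝ) := {p | 0 ≤ p.1 ∧ 0 ≤ p.2 ∧ p.1 + p.2 ≤ 1}

variable (M : Type*)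

/-- Formal integer combinations of singular 1-simplices (maps `[0,1] → M`). -/
abbrev Chain₁ : Type _ := (unitInterval → M) →₀ ℤ

/-- Formal integer combinations of singular 2-simplices. A 2-simplex is given by a map on `ℝ²`
of which only the restriction to the triangle matters. -/
abbrev Chain₂ : Type _ := (ℝ × ℝ → M) →₀ ℤ

/-- The boundary `∂γ = γ(1) - γ(0)` of 1-chains. -/
def boundary₁ : Chain₁ M →ₗ[ℤ] (M →₀ ℤ) :=
  Finsupp.linearCombination ℤ fun γ ↦ Finsupp.single (γ 1) 1 - Finsupp.single (γ 0) 1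

/-- The boundary of 2-chains: the alternating sum of the three faces of each simplex. -/
def boundary₂ : Chain₂ M →ₗ[ℤ] Chain₁ M :=
  Finsupp.linearCombination ℤ fun σ ↦
    Finsupp.single (fun t : unitInterval ↦ σ (1 - t, t)) 1
      - Finsupp.single (fun t : unitInterval ↦ σ (0, t)) 1
      + Finsupp.single (fun t : unitInterval ↦ σ (t, 0)) 1

variable [TopologicalSpace M] [ChartedSpace Plane M]

/-- The `C^1` 2-chains: combinations of maps that are `C^1` on the closed triangle. -/
def smoothChain₂ : Submodule ℤ (Chain₂ M) :=
  Finsupp.supported ℤ ℤ {σ | ContMDiffOn 𝓘(ℝ, ℝ × ℝ) (𝓡 2) 1 σ triangle}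

/-- The `C^1` 1-cycles. -/
def cycles₁ : Submodule ℤ (Chain₁ M) :=
  Finsupp.supported ℤ ℤ {γ | ContMDiff (𝓡∂ 1) (𝓡 2) 1 γ} ⊓ LinearMap.ker (boundary₁ M)

/-- The 1-boundaries: boundaries of `C^1` 2-chains. -/
def boundaries₁ : Submodule ℤ (Chain₁ M) := (smoothChain₂ M).map (boundary₂ M)

/-- The first homology `H_1(M, ℤ)`, cycles modulo boundaries, as a submodule of chains modulo
boundaries. -/
def firstHomology : Submodule ℤ (Chain₁ M ⧸ boundaries₁ M) :=
  (cycles₁ M).map (boundaries₁ M).mkQ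

/-- An oriented closed `C^1` curve, parametrized by `[0,1]`; a corner at the base point is
allowed. -/
structure ClosedCurve where
  toFun : unitInterval → M
  contMDiff : ContMDiff (𝓡∂ 1) (𝓡 2) 1 toFun
  closed : toFun 0 = toFun 1

variable {M}

/-- The class of a closed curve modulo boundaries (it lies in `firstHomology M`). -/
def ClosedCurve.homologyClass (l : ClosedCurve M) : Chain₁ M ⧸ boundaries₁ M :=
  (boundaries₁ M).mkQ (Finsupp.single l.toFun 1)

/-- The homology classes of the closed curves `l i` form a basis of `H_1(M, ℤ)`. -/
def IsHomologyBasis {ι : Type*} (l : ι → ClosedCurve M) : Prop :=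
  LinearIndependent ℤ (fun i ↦ (l i).homologyClass) ∧
    Submodule.span ℤ (Set.range fun i ↦ (l i).homologyClass) = firstHomology M

end Chains

section Flux

variable {M : Type*} [TopologicalSpace M] [ChartedSpace Plane M] [IsManifold (𝓡 2) ∞ M]

/-- The integral `∫_σ Ω = ∫_Δ σ^* Ω` of `Ω` over a 2-simplex. -/
def simplexIntegral (Ω : AreaForm M) (σ : ℝ × ℝ → M) : ℝ :=
  ∫ p in triangle, Ω.toFun (σ p)
    (mfderivWithin 𝓘(ℝ, ℝ × ℝ) (𝓡 2) σ triangle p ((1, 0) : ℝ × ℝ))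
    (mfderivWithin 𝓘(ℝ, ℝ × ℝ) (𝓡 2) σ triangle p ((0, 1) : ℝ × ℝ))

/-- The integral `∫_D Ω` of `Ω` over a 2-chain. -/
def chainIntegral (Ω : AreaForm M) (D : Chain₂ M) : ℝ :=
  D.sum fun σ n ↦ (n : ℝ) * simplexIntegral Ω σ

/-- `c ∈ ℝ/ℤ` is the flux of `f` across the closed curve `l`: there is a 2-chain `D` with
`∂D = f(l) - l` and `c = ∫_D Ω mod 1`. When `M` is closed, connected and of total area one,
the integral of `Ω` over a 2-cycle is an integer, so that there is at most one such `c`. -/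
def IsFlux (Ω : AreaForm M) (f : M → M) (l : ClosedCurve M) (c : UnitAddCircle) : Prop :=
  ∃ D ∈ smoothChain₂ M,
    boundary₂ M D = Finsupp.single (f ∘ l.toFun) 1 - Finsupp.single l.toFun 1 ∧
    ((chainIntegral Ω D : ℝ) : UnitAddCircle) = c

/-- `v` is the flux vector of `f` with respect to the closed curves `l i`. -/
def IsFluxVector {ι : Type*} (Ω : AreaForm M) (f : M → M) (l : ι → ClosedCurve M)
    (v : ι → UnitAddCircle) : Prop :=
  ∀ i, IsFlux Ω f (l i) (v i)

/-- All components of the vector `v` in the torus are rational. -/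
def IsRationalVector {ι : Type*} (v : ι → UnitAddCircle) : Prop :=
  ∀ i, ∃ q : ℚ, v i = ((q : ℝ) : UnitAddCircle)

end Flux

end SurfaceFlux

end

/-! The flux of a map across a curve can be moved by composing the map with a flow. A homomorphism
`c` from 1-chains modulo boundaries to ℝ is represented by a smooth closed 1-form α. The field X
with Ω(X, ·) = α has a flow φ_t, defined for all times because M is compact, and Cartan's formula
shows that φ_t preserves Ω. Since φ_t preserves X as well, the area that a closed curve γ sweeps out
per unit of time is constant and equals c([γ]); in time T the swept area is T c([γ]).

If f has flux s across l, then f(l) is homologous to l, so adjoining the swept cylinder to the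
2-chain shows that φ_T ∘ f has flux s + T c([l]). The classes of the given curves are linearly
independent and ℝ is an injective group, so for each i some `c` takes the value 1 on the i-th class
and 0 on the others. Its flow changes the i-th flux and no other, and an arbitrarily small time
makes that flux rational. The fluxes are corrected one after another inside an open neighbourhood,
which is possible because φ_t ∘ f tends to f in the C^r topology.

The lemmas that carry this are `exists_flow` (smooth global flow), `pathClass_eq_of_homotopic` (a
map homotopic to the identity has a flux), `nonempty_smoothPotential` (the closed 1-form with given
periods), `pullback_flow_eq` and `chainIntegral_sweep` (invariance and swept area),
`exists_dual_hom`, `AreaFlow.tendsto_comp`, and the induction `exists_hasFlux_rational`. The 1-form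
is handled throughout by its local primitives, which are compared with the classes of straight paths
in charts. -/

noncomputable section

universe u

namespace SurfaceFlux

/-! ### Superposition operators on spaces of continuous curves -/

section Superposition

variable {J : Type*} [TopologicalSpace J] [CompactSpace J]

/-- Pointwise evaluation of a continuous family of linear maps at a continuous family of vectors,
as a bounded bilinear map on spaces of continuous functions. -/
def pointwiseApply (J : Type*) [TopologicalSpace J] [CompactSpace J]
    (E F : Type*) [NormedAddCommGroup E] [NormedSpace ℝ E]
    [NormedAddCommGroup F] [NormedSpace ℝ F] : C(J, E →L[ℝ] F) →L[ℝ] C(J, E) →L[ℝ] C(J, F) :=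
  LinearMap.mkContinuous₂
    (LinearMap.mk₂ ℝ (fun (A : C(J, E →L[ℝ] F)) (γ : C(J, E)) ↦
        (⟨fun s ↦ A s (γ s), A.continuous.clm_apply γ.continuous⟩ : C(J, F)))
      (fun _ _ _ ↦ by ext; simp) (fun _ _ _ ↦ by ext; simp)
      (fun _ _ _ ↦ by ext; simp) (fun _ _ _ ↦ by ext; simp)) 1
    (fun A γ ↦ by
      rw [one_mul]
      refine (ContinuousMap.norm_le _ (by positivity)).2 fun s ↦ ?_
      refine ((A s).le_opNorm _).trans ?_
      gcongr
      · exact A.norm_coe_le_norm s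
      · exact γ.norm_coe_le_norm s)

/-- The mean value inequality on each segment from γ(s) to γ(s) + η(s) bounds the remainder by the
oscillation of `fderiv ℝ f` there, so the estimate must be uniform in s. -/
theorem hasFDerivAt_superposition {E F : Type*} [NormedAddCommGroup E] [NormedSpace ℝ E]
    [NormedAddCommGroup F] [NormedSpace ℝ F] {f : E → F} (hf : ContDiff ℝ 1 f) (γ : C(J, E)) :
    HasFDerivAt (fun γ : C(J, E) ↦ (⟨f, hf.continuous⟩ : C(E, F)).comp γ)
      (pointwiseApply J E F ((⟨fderiv ℝ f, hf.continuous_fderiv one_ne_zero⟩ :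
        C(E, E →L[ℝ] F)).comp γ)) γ := by
  set D : C(E, E →L[ℝ] F) := ⟨fderiv ℝ f, hf.continuous_fderiv one_ne_zero⟩ with hD
  rw [hasFDerivAt_iff_isLittleO_nhds_zero, Asymptotics.isLittleO_iff]
  intro c hc
  -- Continuity of postcomposition in the sup norm supplies the uniformity in s; local compactness
  -- of E is not needed.
  have hcont : Continuous fun η : C(J, E) ↦ D.comp η := ContinuousMap.continuous_postcomp D
  obtain ⟨δ, hδ, hball⟩ := Metric.eventually_nhds_iff.1
    ((hcont.tendsto γ).eventually (Metric.ball_mem_nhds (D.comp γ) hc))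
  filter_upwards [Metric.ball_mem_nhds (0 : C(J, E)) hδ] with η hη
  rw [mem_ball_zero_iff] at hη
  refine (ContinuousMap.norm_le _ (by positivity)).2 fun s ↦ ?_
  have hseg : ∀ y ∈ segment ℝ (γ s) (γ s + η s), ‖fderiv ℝ f y - fderiv ℝ f (γ s)‖ ≤ c := by
    intro y hy
    rw [segment_eq_image'] at hy
    obtain ⟨θ, hθ, rfl⟩ := hy
    have h1 : dist (γ + θ • η) γ < δ := by
      rw [dist_eq_norm, add_sub_cancel_left, norm_smul, Real.norm_of_nonneg hθ.1]
      exact (mul_le_of_le_one_left (norm_nonneg _) hθ.2).trans_lt hη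
    have h2 := (ContinuousMap.dist_lt_iff hc).1 (hball h1) s
    rw [dist_eq_norm] at h2
    simpa [hD] using h2.le
  have key := (convex_segment (γ s) (γ s + η s)).norm_image_sub_le_of_norm_hasFDerivWithin_le'
    (fun y _ ↦ (hf.differentiable one_ne_zero y).hasFDerivAt.hasFDerivWithinAt) hseg
    (left_mem_segment ℝ _ _) (right_mem_segment ℝ _ _)
  rw [add_sub_cancel_left] at key
  refine key.trans ?_
  gcongr
  exact η.norm_coe_le_norm s

/-- A `C^∞` map induces a `C^∞` superposition operator on continuous functions. -/
theorem contDiff_superposition {E F : Type u} [NormedAddCommGroup E] [NormedSpace ℝ E]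
    [NormedAddCommGroup F] [NormedSpace ℝ F] {f : E → F} (hf : ContDiff ℝ ∞ f) :
    ContDiff ℝ ∞ (fun γ : C(J, E) ↦ (⟨f, hf.continuous⟩ : C(E, F)).comp γ) := by
  rw [contDiff_infty]
  intro n
  -- The derivative is the superposition operator of `fderiv ℝ f` followed by a bounded linear map.
  -- The target thus becomes `E →L[ℝ] F`, which stays in the universe `u`.
  induction n generalizing F with
  | zero => exact contDiff_zero.2 (ContinuousMap.continuous_postcomp _)
  | succ n ih =>
    have hf1 : ContDiff ℝ 1 f := hf.of_le (by simp)
    have hd : ContDiff ℝ ∞ (fderiv ℝ f) := hf.fderiv_right (by simp)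
    refine (contDiff_succ_iff_hasFDerivAt (n := n)).2 ⟨_, ?_, hasFDerivAt_superposition hf1⟩
    exact (pointwiseApply J E F).contDiff.comp (ih hd)

end Superposition

/-! ### Local flows in a vector space, by the implicit function theorem -/

section LocalFlow

variable {E : Type u} [NormedAddCommGroup E] [NormedSpace ℝ E]

/-- The time interval on which rescaled local integral curves live. -/
abbrev TimeInterval : Type := Set.Icc (-1 : ℝ) 2

theorem neg_one_le_two_real : (-1 : ℝ) ≤ 2 := by norm_num

variable (E) in
/-- The integration operator `β ↦ (s ↦ ∫₀ˢ β)` on continuous curves. -/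
def integrateCurve [CompleteSpace E] : C(TimeInterval, E) →L[ℝ] C(TimeInterval, E) :=
  LinearMap.mkContinuous
    { toFun := fun β ↦ ⟨fun s ↦ ∫ τ in (0 : ℝ)..s, Set.IccExtend neg_one_le_two_real β τ,
        (intervalIntegral.continuous_primitive
          (fun _ _ ↦ (β.continuous.Icc_extend' (h := neg_one_le_two_real)).intervalIntegrable _ _)
            0).comp continuous_subtype_val⟩
      map_add' := fun β β' ↦ by
        ext s
        exact intervalIntegral.integral_add
          ((β.continuous.Icc_extend' (h := neg_one_le_two_real)).intervalIntegrable _ _)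
          ((β'.continuous.Icc_extend' (h := neg_one_le_two_real)).intervalIntegrable _ _)
      map_smul' := fun c β ↦ by
        ext s
        exact intervalIntegral.integral_smul c _ } 2
    (fun β ↦ by
      refine (ContinuousMap.norm_le _ (by positivity)).2 fun s ↦ ?_
      refine (intervalIntegral.norm_integral_le_of_norm_le_const (C := ‖β‖)
        fun τ _ ↦ β.norm_coe_le_norm _).trans ?_
      rw [mul_comm]
      gcongr
      rw [sub_zero, abs_le]
      exact ⟨by linarith [s.2.1], s.2.2⟩)

theorem integrateCurve_apply [CompleteSpace E] (β : C(TimeInterval, E)) (s : TimeInterval) :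
    integrateCurve E β s = ∫ τ in (0 : ℝ)..s, Set.IccExtend neg_one_le_two_real β τ := rfl

/-- Local solutions of `γ' = t f(γ)`, `γ 0 = x`, on the fixed time interval, depending smoothly
on `(t, x)` near `(0, x₀)`. -/
theorem exists_contDiffAt_integral_solution [CompleteSpace E] {f : E → E} (hf : ContDiff ℝ ∞ f)
    (x₀ : E) :
    ∃ Ψ : ℝ × E → C(TimeInterval, E), ContDiffAt ℝ ∞ Ψ (0, x₀) ∧
      Ψ (0, x₀) = ContinuousMap.const _ x₀ ∧
      ∀ᶠ p in 𝓝 ((0 : ℝ), x₀), Ψ p = ContinuousMap.const _ p.2 +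
        p.1 • integrateCurve E ((⟨f, hf.continuous⟩ : C(E, E)).comp (Ψ p)) := by
  let N : C(TimeInterval, E) → C(TimeInterval, E) := fun γ ↦
    integrateCurve E ((⟨f, hf.continuous⟩ : C(E, E)).comp γ)
  have hN : ContDiff ℝ ∞ N := (integrateCurve E).contDiff.comp (contDiff_superposition hf)
  let K : E →L[ℝ] C(TimeInterval, E) := ContinuousLinearMap.const ℝ TimeInterval
  -- Zeros of `G` are the rescaled integral curves. At t = 0 the nonlinear term vanishes, so the
  -- partial derivative in the curve is the identity, and the implicit function theorem gives
  -- solutions smooth in (t, x).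
  let G : (ℝ × E) × C(TimeInterval, E) → C(TimeInterval, E) := fun q ↦
    q.2 - K q.1.2 - q.1.1 • N q.2
  have hG : ContDiff ℝ ∞ G :=
    (contDiff_snd.sub (K.contDiff.comp (contDiff_snd.comp contDiff_fst))).sub
      ((contDiff_fst.comp contDiff_fst).smul (hN.comp contDiff_snd))
  set u : (ℝ × E) × C(TimeInterval, E) := ((0, x₀), K x₀) with hu
  have hGu : G u = 0 := by simp [G, hu]
  have hinv : fderiv ℝ G u ∘L .inr ℝ (ℝ × E) C(TimeInterval, E) = .id ℝ _ := by
    have h1 : HasFDerivAt (fun γ ↦ G ((0, x₀), γ))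
        (fderiv ℝ G u ∘L .inr ℝ (ℝ × E) C(TimeInterval, E)) (K x₀) :=
      ((hG.differentiable (by simp)) u).hasFDerivAt.comp (K x₀) (hasFDerivAt_prodMk_right _ _)
    have h2 : HasFDerivAt (fun γ ↦ G ((0, x₀), γ)) (.id ℝ _) (K x₀) := by
      have : (fun γ ↦ G ((0, x₀), γ)) = fun γ ↦ γ - K x₀ := by ext; simp [G]
      rw [this]
      exact (hasFDerivAt_id _).sub_const _
    exact h1.unique h2
  have hinv' : (fderiv ℝ G u ∘L .inr ℝ (ℝ × E) C(TimeInterval, E)).IsInvertible := by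
    rw [hinv]; exact ⟨.refl ℝ _, rfl⟩
  have hG' : ContDiffAt ℝ ∞ G u := hG.contDiffAt
  refine ⟨hG'.implicitFunction (by simp) hinv', hG'.contDiffAt_implicitFunction _ _,
    hG'.implicitFunction_apply_self _ _, ?_⟩
  filter_upwards [hG'.eventually_apply_implicitFunction (by simp) hinv'] with p hp
  rw [hGu] at hp
  have : _ = _ := sub_eq_zero.1 hp
  rw [sub_eq_iff_eq_add'] at this
  exact this

/-- The local flow of a vector field that is smooth near `x₀`, with smooth dependence on time and
initial value. The point `Φ (t, x)` is the value at time `1` of an integral curve of `t f` that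
starts at `x`. -/
theorem exists_local_flow [FiniteDimensional ℝ E] {f : E → E} {U : Set E} (hU : IsOpen U)
    (hf : ContDiffOn ℝ ∞ f U) {x₀ : E} (hx₀ : x₀ ∈ U) :
    ∃ Φ : ℝ × E → E, ContDiffAt ℝ ∞ Φ (0, x₀) ∧ Φ (0, x₀) = x₀ ∧
      ∀ᶠ p in 𝓝 ((0 : ℝ), x₀), ∃ γ : ℝ → E, γ 0 = p.2 ∧ γ 1 = Φ p ∧
        ∀ s ∈ Set.Ioo (-1 : ℝ) 2, γ s ∈ U ∧ HasDerivAt γ (p.1 • f (γ s)) s := by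
  have : CompleteSpace E := FiniteDimensional.complete ℝ E
  obtain ⟨r, hr, hrU⟩ := Metric.isOpen_iff.1 hU x₀ hx₀
  -- The cutoff makes the field smooth on all of E and leaves it unchanged on the ball of radius
  -- r/3, in which the solutions close to the constant curve x₀ remain.
  let b : ContDiffBump x₀ := ⟨r / 3, r / 2, by positivity, by linarith⟩
  have hbf : ContDiff ℝ ∞ (fun x ↦ b x • f x) := by
    rw [contDiff_iff_contDiffAt]
    intro x
    by_cases hx : x ∈ Metric.ball x₀ r
    · exact b.contDiff.contDiffAt.smul (hf.contDiffAt (hU.mem_nhds (hrU hx)))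
    · have : ∀ᶠ y in 𝓝 x, b y • f y = 0 := by
        have : x ∉ tsupport b := by
          rw [b.tsupport_eq]
          intro h
          exact hx (Metric.closedBall_subset_ball (show b.rOut < r by simp only [b]; linarith) h)
        filter_upwards [(isClosed_tsupport b).isOpen_compl.mem_nhds this] with y hy
        rw [image_eq_zero_of_notMem_tsupport hy, zero_smul]
      exact contDiffAt_const.congr_of_eventuallyEq this
  obtain ⟨Ψ, hΨ, hΨ0, hΨe⟩ := exists_contDiffAt_integral_solution hbf x₀
  let e : TimeInterval → C(TimeInterval, E) →L[ℝ] E := fun s ↦ ContinuousMap.evalCLM ℝ s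
  have h0 : (0 : ℝ) ∈ Set.Icc (-1 : ℝ) 2 := by norm_num
  have h1 : (1 : ℝ) ∈ Set.Icc (-1 : ℝ) 2 := by norm_num
  refine ⟨fun p ↦ Ψ p ⟨1, h1⟩, (e ⟨1, h1⟩).contDiff.contDiffAt.comp _ hΨ, by simp [hΨ0], ?_⟩
  have hclose : ∀ᶠ p in 𝓝 ((0 : ℝ), x₀), Ψ p ∈ Metric.ball (ContinuousMap.const _ x₀) (r / 3) :=
    hΨ.continuousAt.eventually (hΨ0 ▸ Metric.ball_mem_nhds _ (by positivity))
  filter_upwards [hΨe, hclose] with p hp hpc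
  set γ : ℝ → E := Set.IccExtend neg_one_le_two_real (Ψ p) with hγ
  have hγc : Continuous γ := (Ψ p).continuous.Icc_extend'
  have hball : ∀ s, γ s ∈ Metric.ball x₀ (r / 3) := fun s ↦
    (ContinuousMap.dist_lt_iff (by positivity)).1 hpc _
  have hbump : ∀ s, b (γ s) = 1 := fun s ↦
    b.one_of_mem_closedBall (Metric.ball_subset_closedBall (hball s))
  have hint : ∀ s ∈ Set.Icc (-1 : ℝ) 2, γ s = p.2 + p.1 • ∫ τ in (0 : ℝ)..s, f (γ τ) := by
    intro s hs
    have h := congrArg (fun η : C(TimeInterval, E) ↦ η ⟨s, hs⟩) hp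
    simp only [ContinuousMap.add_apply, ContinuousMap.smul_apply, ContinuousMap.const_apply,
      integrateCurve_apply] at h
    rw [hγ, Set.IccExtend_of_mem _ _ hs, h]
    congr 2
    refine intervalIntegral.integral_congr fun τ _ ↦ ?_
    change b (γ τ) • f (γ τ) = f (γ τ)
    rw [hbump, one_smul]
  have hfc : Continuous fun τ ↦ f (γ τ) := by
    refine hf.continuousOn.comp_continuous hγc fun s ↦ hrU ?_
    exact Metric.ball_subset_ball (by linarith) (hball s)
  refine ⟨γ, ?_, Set.IccExtend_of_mem _ _ h1, fun s hs ↦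
    ⟨hrU (Metric.ball_subset_ball (by linarith) (hball s)), ?_⟩⟩
  · simpa using hint 0 h0
  · have hd : HasDerivAt (fun s ↦ p.2 + p.1 • ∫ τ in (0 : ℝ)..s, f (γ τ)) (p.1 • f (γ s)) s :=
      ((intervalIntegral.integral_hasDerivAt_right (hfc.intervalIntegrable _ _)
        (hfc.stronglyMeasurableAtFilter _ _) hfc.continuousAt).const_smul p.1).const_add p.2
    refine hd.congr_of_eventuallyEq ?_
    filter_upwards [Icc_mem_nhds hs.1 hs.2] with s' hs'
    exact hint s' hs'

end LocalFlow

/-! ### Global flows of vector fields on compact surfaces -/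

section ManifoldFlow

variable {M : Type*} [TopologicalSpace M] [ChartedSpace Plane M] [IsManifold (𝓡 2) ∞ M]

theorem mfderiv_chart_symm_mfderiv_chart {x₀ p : M} (hp : p ∈ (chartAt Plane x₀).source)
    (v : TangentSpace (𝓡 2) p) :
    mfderiv (𝓡 2) (𝓡 2) (chartAt Plane x₀).symm (chartAt Plane x₀ p)
      (mfderiv (𝓡 2) (𝓡 2) (chartAt Plane x₀) p v) = v :=
  congrArg (fun A ↦ A v) ((mdifferentiable_chart (I := 𝓡 2) x₀).symm_comp_deriv hp)

theorem mfderiv_chart_mfderiv_chart_symm {x₀ : M} {y : Plane} (hy : y ∈ (chartAt Plane x₀).target)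
    (v : Plane) :
    mfderiv (𝓡 2) (𝓡 2) (chartAt Plane x₀) ((chartAt Plane x₀).symm y)
      (mfderiv (𝓡 2) (𝓡 2) (chartAt Plane x₀).symm y v) = v :=
  congrArg (fun A ↦ A v) ((mdifferentiable_chart (I := 𝓡 2) x₀).comp_symm_deriv hy)

theorem mfderiv_chart_symm_mfderiv_chart' {x₀ : M} {y : Plane}
    (hy : y ∈ (chartAt Plane x₀).target) (v : TangentSpace (𝓡 2) ((chartAt Plane x₀).symm y)) :
    mfderiv (𝓡 2) (𝓡 2) (chartAt Plane x₀).symm y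
      (mfderiv (𝓡 2) (𝓡 2) (chartAt Plane x₀) ((chartAt Plane x₀).symm y) v) = v := by
  have h := mfderiv_chart_symm_mfderiv_chart ((chartAt Plane x₀).map_target hy) v
  -- All tangent spaces unfold to `Plane`, so a base point is changed by substitution in an equation
  -- between vectors of `Plane`. The same device recurs below.
  have h2 : ∀ z : Plane, z = y → ∀ w : Plane,
      (mfderiv (𝓡 2) (𝓡 2) (chartAt Plane x₀).symm z w : Plane) =
        mfderiv (𝓡 2) (𝓡 2) (chartAt Plane x₀).symm y w := by
    rintro z rfl w; rfl
  exact (h2 _ ((chartAt Plane x₀).right_inv hy) _).symm.trans h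

/-- The component of a tangent vector in the trivialization at `x₀` is given by the derivative of
the chart. -/
theorem trivializationAt_apply_eq_mfderiv {x₀ p : M} (hp : p ∈ (chartAt Plane x₀).source)
    (v : TangentSpace (𝓡 2) p) :
    ((trivializationAt Plane (TangentSpace (𝓡 2) : M → Type _) x₀) ⟨p, v⟩).2 =
      mfderiv (𝓡 2) (𝓡 2) (chartAt Plane x₀) p v := by
  have h4 := congrArg (fun A ↦ A v)
    (TangentBundle.continuousLinearMapAt_trivializationAt (I := 𝓡 2) hp)
  have h5 := Bundle.Trivialization.coe_linearMapAt_of_mem (R := ℝ)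
    (trivializationAt Plane (TangentSpace (𝓡 2) : M → Type _) x₀) (b := p) (by simpa using hp)
  exact (congrFun h5 _).symm.trans h4

/-- The vector field `X` read in the chart at `x₀`. -/
def fieldInChart (X : (x : M) → TangentSpace (𝓡 2) x) (x₀ : M) (y : Plane) : Plane :=
  mfderiv (𝓡 2) (𝓡 2) (chartAt Plane x₀) ((chartAt Plane x₀).symm y)
    (X ((chartAt Plane x₀).symm y))

theorem contDiffOn_fieldInChart {X : (x : M) → TangentSpace (𝓡 2) x}
    (hX : ContMDiff (𝓡 2) (𝓡 2).tangent ∞ (fun x ↦ (⟨x, X x⟩ : TangentBundle (𝓡 2) M))) (x₀ : M) :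
    ContDiffOn ℝ ∞ (fieldInChart X x₀) (chartAt Plane x₀).target := by
  have h1 := ((trivializationAt Plane (TangentSpace (𝓡 2) : M → Type _)
    x₀).contMDiffOn_section_baseSet_iff (IB := 𝓡 2) (n := ∞) (s := X)).1 hX.contMDiffOn
  have h2 := h1.comp (contMDiffOn_chart_symm (I := 𝓡 2) (n := ∞) (x := x₀)) (fun y hy ↦ by
    simpa using (chartAt Plane x₀).map_target hy)
  refine (contMDiffOn_iff_contDiffOn.1 h2).congr fun y hy ↦ ?_
  exact (trivializationAt_apply_eq_mfderiv ((chartAt Plane x₀).map_target hy) _).symm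

/-- A solution of the ODE in a chart gives an integral curve on the manifold. -/
theorem isMIntegralCurveOn_of_chart {X : (x : M) → TangentSpace (𝓡 2) x} {x₀ : M} {t : ℝ}
    {γ : ℝ → Plane} {s : Set ℝ} (hγ : ∀ τ ∈ s, γ τ ∈ (chartAt Plane x₀).target ∧
      HasDerivAt γ (t • fieldInChart X x₀ (γ τ)) τ) :
    IsMIntegralCurveOn (fun τ ↦ (chartAt Plane x₀).symm (γ τ)) (fun x ↦ t • X x) s := by
  intro τ hτ
  obtain ⟨hmem, hd⟩ := hγ τ hτ
  have he := mdifferentiable_chart (I := 𝓡 2) x₀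
  have h1 : HasMFDerivAt 𝓘(ℝ, ℝ) (𝓡 2) γ τ
      (ContinuousLinearMap.smulRight (1 : ℝ →L[ℝ] ℝ) (t • fieldInChart X x₀ (γ τ))) :=
    hd.hasFDerivAt.hasMFDerivAt
  have h2 := ((he.mdifferentiableAt_symm hmem).hasMFDerivAt.comp τ h1).hasMFDerivWithinAt (s := s)
  have h3 : mfderiv (𝓡 2) (𝓡 2) (chartAt Plane x₀).symm (γ τ) (t • fieldInChart X x₀ (γ τ)) =
      t • X ((chartAt Plane x₀).symm (γ τ)) := by
    exact (ContinuousLinearMap.map_smul _ t _).trans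
      (congrArg (t • ·) (mfderiv_chart_symm_mfderiv_chart' hmem _))
  refine h2.congr_mfderiv ?_
  refine ContinuousLinearMap.ext_ring ?_
  change mfderiv (𝓡 2) (𝓡 2) (chartAt Plane x₀).symm (γ τ)
    ((1 : ℝ) • (t • fieldInChart X x₀ (γ τ))) = (1 : ℝ) • t • X ((chartAt Plane x₀).symm (γ τ))
  rw [one_smul, one_smul, h3]

/-- Local flow of a smooth vector field on a surface, with smooth dependence on all data. -/
theorem exists_local_flow_manifold {X : (x : M) → TangentSpace (𝓡 2) x}
    (hX : ContMDiff (𝓡 2) (𝓡 2).tangent ∞ (fun x ↦ (⟨x, X x⟩ : TangentBundle (𝓡 2) M))) (x₀ : M) :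
    ∃ Φ : ℝ × M → M, ContMDiffAt (𝓘(ℝ, ℝ).prod (𝓡 2)) (𝓡 2) ∞ Φ (0, x₀) ∧
      ∀ᶠ p in 𝓝 ((0 : ℝ), x₀), ∃ γ : ℝ → M, γ 0 = p.2 ∧ γ 1 = Φ p ∧
        IsMIntegralCurveOn γ (fun x ↦ p.1 • X x) (Set.Ioo (-1 : ℝ) 2) := by
  set e := chartAt Plane x₀ with he
  have hx₀ : x₀ ∈ e.source := mem_chart_source Plane x₀
  obtain ⟨Φ, hΦ, hΦ0, hΦe⟩ := exists_local_flow e.open_target (contDiffOn_fieldInChart hX x₀)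
    (e.map_source hx₀)
  have hchart : ContMDiffAt (𝓘(ℝ, ℝ).prod (𝓡 2)) (𝓘(ℝ, ℝ × Plane)) ∞
      (fun p : ℝ × M ↦ (p.1, e p.2)) (0, x₀) := by
    rw [modelWithCornersSelf_prod, ← chartedSpaceSelf_prod]
    refine contMDiffAt_fst.prodMk ?_
    exact ((contMDiffOn_chart (I := 𝓡 2) (x := x₀)).contMDiffAt
      (e.open_source.mem_nhds hx₀)).comp (0, x₀) contMDiffAt_snd
  refine ⟨fun p ↦ e.symm (Φ (p.1, e p.2)), ?_, ?_⟩
  · have h1 : ContMDiffAt (𝓘(ℝ, ℝ).prod (𝓡 2)) (𝓡 2) ∞ (fun p : ℝ × M ↦ Φ (p.1, e p.2))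
        (0, x₀) := (hΦ.contMDiffAt (x := ((0 : ℝ), e x₀))).comp ((0 : ℝ), x₀) hchart
    refine ContMDiffAt.comp ((0 : ℝ), x₀) (g := e.symm) ?_ h1
    simp only [hΦ0]
    exact (contMDiffOn_chart_symm (I := 𝓡 2) (x := x₀)).contMDiffAt
      (e.open_target.mem_nhds (e.map_source hx₀))
  · have h2 : ∀ᶠ p in 𝓝 ((0 : ℝ), x₀), p.2 ∈ e.source :=
      continuousAt_snd.eventually (e.open_source.mem_nhds hx₀)
    filter_upwards [hchart.continuousAt.eventually hΦe, h2] with p hp hps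
    obtain ⟨γ, hγ0, hγ1, hγ⟩ := hp
    refine ⟨fun s ↦ e.symm (γ s), ?_, ?_, isMIntegralCurveOn_of_chart hγ⟩
    · simp only [hγ0]
      exact e.left_inv hps
    · simp only [hγ1]

/-- **The flow of a smooth vector field** on a closed surface: it exists for all times and is
jointly smooth. -/
theorem exists_flow [T2Space M] [CompactSpace M] {X : (x : M) → TangentSpace (𝓡 2) x}
    (hX : ContMDiff (𝓡 2) (𝓡 2).tangent ∞ (fun x ↦ (⟨x, X x⟩ : TangentBundle (𝓡 2) M))) :
    ∃ φ : ℝ → M → M, (∀ x, φ 0 x = x) ∧ (∀ s t x, φ (s + t) x = φ s (φ t x)) ∧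
      (∀ x, IsMIntegralCurve (fun t ↦ φ t x) X) ∧
      ContMDiff (𝓘(ℝ, ℝ).prod (𝓡 2)) (𝓡 2) ∞ (fun p : ℝ × M ↦ φ p.1 p.2) := by
  have hX1 : ContMDiff (𝓡 2) (𝓡 2).tangent 1
    (fun x ↦ (⟨x, X x⟩ : TangentBundle (𝓡 2) M)) := hX.of_le (by simp)
  choose Φ hΦ hΦe using exists_local_flow_manifold hX
  have hunif : ∀ᶠ t in 𝓝 (0 : ℝ), ∀ x ∈ (Set.univ : Set M), ∃ γ : ℝ → M, γ 0 = x ∧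
      IsMIntegralCurveOn γ (fun x ↦ t • X x) (Set.Ioo (-1 : ℝ) 2) := by
    refine isCompact_univ.eventually_forall_of_forall_eventually fun x₀ _ ↦ ?_
    filter_upwards [hΦe x₀] with p ⟨γ, h0, _, hγ⟩
    exact ⟨γ, h0, hγ⟩
  obtain ⟨δ, hδ, hδu⟩ := Metric.eventually_nhds_iff.1 hunif
  have hglobal : ∀ x : M, ∃ γ : ℝ → M, γ 0 = x ∧ IsMIntegralCurve γ X := by
    refine exists_isMIntegralCurve_of_isMIntegralCurveOn hX1 (half_pos hδ) fun x ↦ ?_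
    obtain ⟨γ, hγ0, hγ⟩ := hδu (y := δ / 2) (by simp [abs_of_pos hδ]; linarith) x (Set.mem_univ x)
    -- The curve for the parameter δ/2 solves γ' = (δ/2) X on (-1, 2); undoing the scaling gives an
    -- integral curve of X on (-δ/2, δ), hence on a symmetric interval whose length does not depend
    -- on x.
    refine ⟨γ ∘ (· * (δ / 2)⁻¹), by simp [hγ0], ?_⟩
    have h := hγ.comp_mul (δ / 2)⁻¹
    have h2 : ((δ / 2)⁻¹ • fun x ↦ (δ / 2) • X x) = X := by
      funext x
      simp only [Pi.smul_apply]
      rw [smul_smul, inv_mul_cancel₀ (half_pos hδ).ne', one_smul]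
    rw [h2] at h
    refine h.mono fun t ht ↦ ?_
    have hd := half_pos hδ
    constructor
    · have := mul_lt_mul_of_pos_right ht.1 (inv_pos.2 hd)
      rwa [neg_mul, mul_inv_cancel₀ hd.ne'] at this
    · have := mul_lt_mul_of_pos_right ht.2 (inv_pos.2 hd)
      rw [mul_inv_cancel₀ hd.ne'] at this
      exact this.trans (by norm_num)
  choose ψ hψ0 hψ using hglobal
  have huniq {γ γ' : ℝ → M} (h : IsMIntegralCurve γ X) (h' : IsMIntegralCurve γ' X)
      (h0 : γ 0 = γ' 0) : γ = γ' :=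
    isMIntegralCurve_Ioo_eq_of_contMDiff_boundaryless hX1 h h' h0
  have hgroup : ∀ s t x, ψ x (s + t) = ψ (ψ x t) s := fun s t x ↦
    congrFun (huniq ((hψ x).comp_add t) (hψ (ψ x t)) (by simp [hψ0])) s
  have hzero : ∀ x₀ : M, ContMDiffAt (𝓘(ℝ, ℝ).prod (𝓡 2)) (𝓡 2) ∞
      (fun p : ℝ × M ↦ ψ p.2 p.1) (0, x₀) := by
    intro x₀
    refine (hΦ x₀).congr_of_eventuallyEq ?_
    filter_upwards [hΦe x₀] with p ⟨γ, h0, h1, hγ⟩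
    -- By uniqueness the rescaled global curve agrees with the local one; at parameter 1 this
    -- identifies the flow with the smooth map `Φ x₀`.
    have h2 := ((hψ p.2).comp_mul p.1).isMIntegralCurveOn (Set.Ioo (-1 : ℝ) 2)
    have h3 := isMIntegralCurveOn_Ioo_eqOn_of_contMDiff_boundaryless (t₀ := 0) (by norm_num)
      (hX1.const_smul_section (a := p.1)) h2 hγ (by simp [h0, hψ0])
    simpa [h1] using h3 (show (1 : ℝ) ∈ Set.Ioo (-1 : ℝ) 2 by norm_num)
  refine ⟨fun t x ↦ ψ x t, hψ0, hgroup, hψ, ?_⟩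
  -- For finite n, being C^n at a point spreads to a neighbourhood; compactness of M then gives one
  -- time interval around 0 that serves all initial points.
  rw [contMDiff_infty]
  intro n
  have hn : ∀ᶠ t in 𝓝 (0 : ℝ), ∀ x ∈ (Set.univ : Set M),
      ContMDiffAt (𝓘(ℝ, ℝ).prod (𝓡 2)) (𝓡 2) n (fun p : ℝ × M ↦ ψ p.2 p.1) (t, x) := by
    refine isCompact_univ.eventually_forall_of_forall_eventually fun x₀ _ ↦ ?_
    have : IsManifold (𝓡 2) n M := .of_le (n := ∞) (by exact_mod_cast le_top)
    exact (contMDiffAt_iff_contMDiffAt_nhds (by simp)).1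
      ((hzero x₀).of_le (by exact_mod_cast le_top))
  obtain ⟨ε, hε, hεu⟩ := Metric.eventually_nhds_iff.1 hn
  have hsmall : ∀ t : ℝ, |t| < ε → ContMDiff (𝓡 2) (𝓡 2) n (fun x ↦ ψ x t) := fun t ht x ↦
    (hεu (y := t) (by simpa using ht) x (Set.mem_univ x)).comp x
      (contMDiffAt_const.prodMk contMDiffAt_id)
  have hmul : ∀ (N : ℕ) (t : ℝ), |t| < ε → ContMDiff (𝓡 2) (𝓡 2) n (fun x ↦ ψ x (N * t)) := by
    intro N t ht
    induction N with
    | zero =>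
      simp only [Nat.cast_zero, zero_mul, hψ0]
      exact contMDiff_id
    | succ N ih =>
      have : (fun x ↦ ψ x ((N + 1 : ℕ) * t)) = fun x ↦ ψ (ψ x (N * t)) t := by
        funext x
        rw [← hgroup]
        congr 1
        push_cast
        ring
      rw [this]
      exact (hsmall t ht).comp ih
  have hall : ∀ t : ℝ, ContMDiff (𝓡 2) (𝓡 2) n (fun x ↦ ψ x t) := by
    intro t
    obtain ⟨N, hN⟩ := exists_nat_gt (|t| / ε)
    have hN0 : (0 : ℝ) < N := (div_nonneg (abs_nonneg t) hε.le).trans_lt hN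
    have h := hmul N (t / N) (by
      rw [abs_div, abs_of_pos hN0, div_lt_iff₀ hN0]
      rwa [div_lt_iff₀ hε, mul_comm] at hN)
    rwa [mul_div_cancel₀ _ hN0.ne'] at h
  rintro ⟨T, x⟩
  -- Writing φ_t = φ_(t - T) ∘ φ_T moves the question to time 0, given that φ_T itself is smooth.
  have heq : (fun p : ℝ × M ↦ ψ p.2 p.1) =
      (fun p : ℝ × M ↦ ψ p.2 p.1) ∘ fun p : ℝ × M ↦ (p.1 - T, ψ p.2 T) := by
    funext p
    simp only [Function.comp]
    rw [← hgroup, sub_add_cancel]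
  rw [heq]
  have hz := hεu (y := T - T) (by simpa using hε) (ψ x T) (Set.mem_univ _)
  refine ContMDiffAt.comp (T, x) hz ?_
  exact (contMDiffAt_fst.sub contMDiffAt_const).prodMk
    ((hall T).contMDiffAt.comp (T, x) contMDiffAt_snd)

end ManifoldFlow

/-! ### Singular 1-chains modulo boundaries and homotopy invariance -/

section Homology

variable {M : Type*}

theorem boundary₂_single (σ : ℝ × ℝ → M) (n : ℤ) :
    boundary₂ M (Finsupp.single σ n) = n • (Finsupp.single (fun t : unitInterval ↦ σ (1 - t, t)) 1
      - Finsupp.single (fun t : unitInterval ↦ σ (0, t)) 1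
      + Finsupp.single (fun t : unitInterval ↦ σ (t, 0)) 1) := by
  rw [boundary₂, Finsupp.linearCombination_single]

/-- The 2-chain of the square `K : [0,1]² → M`, cut along the diagonal. -/
def squareChain (K : ℝ × ℝ → M) : Chain₂ M :=
  Finsupp.single (fun p : ℝ × ℝ ↦ K (p.2, p.1 + p.2)) 1
    - Finsupp.single (fun p : ℝ × ℝ ↦ K (p.1 + p.2, p.2)) 1

theorem boundary₂_squareChain (K : ℝ × ℝ → M) :
    boundary₂ M (squareChain K) = Finsupp.single (fun t : unitInterval ↦ K (t, 1)) 1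
      - Finsupp.single (fun t : unitInterval ↦ K (t, 0)) 1
      + Finsupp.single (fun t : unitInterval ↦ K (0, t)) 1
      - Finsupp.single (fun t : unitInterval ↦ K (1, t)) 1 := by
  rw [squareChain, map_sub, boundary₂_single, boundary₂_single]
  simp only [sub_add_cancel, zero_add, add_zero, one_smul]
  abel

variable [TopologicalSpace M] [ChartedSpace Plane M]

theorem squareChain_mem_smoothChain₂ {K : ℝ × ℝ → M}
    (hK : ContMDiffOn 𝓘(ℝ, ℝ × ℝ) (𝓡 2) 1 K (Set.Icc 0 1 ×ˢ Set.Icc 0 1)) :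
    squareChain K ∈ smoothChain₂ M := by
  have h1 : ContMDiffOn 𝓘(ℝ, ℝ × ℝ) (𝓡 2) 1 (fun p : ℝ × ℝ ↦ K (p.2, p.1 + p.2)) triangle := by
    refine hK.comp (t := Set.Icc 0 1 ×ˢ Set.Icc 0 1) (f := fun p : ℝ × ℝ ↦ (p.2, p.1 + p.2))
      (ContDiff.contMDiff (by fun_prop)).contMDiffOn ?_
    rintro ⟨x, y⟩ ⟨hx, hy, hxy⟩
    simp only at hx hy hxy
    exact ⟨⟨hy, by simp only; linarith⟩, ⟨by simp only; linarith, hxy⟩⟩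
  have h2 : ContMDiffOn 𝓘(ℝ, ℝ × ℝ) (𝓡 2) 1 (fun p : ℝ × ℝ ↦ K (p.1 + p.2, p.2)) triangle := by
    refine hK.comp (t := Set.Icc 0 1 ×ˢ Set.Icc 0 1) (f := fun p : ℝ × ℝ ↦ (p.1 + p.2, p.2))
      (ContDiff.contMDiff (by fun_prop)).contMDiffOn ?_
    rintro ⟨x, y⟩ ⟨hx, hy, hxy⟩
    simp only at hx hy hxy
    exact ⟨⟨by simp only; linarith, hxy⟩, ⟨hy, by simp only; linarith⟩⟩
  exact Submodule.sub_mem _ (Finsupp.single_mem_supported _ _ h1)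
    (Finsupp.single_mem_supported _ _ h2)

variable (M) in
/-- Singular 1-chains modulo boundaries. -/
abbrev ChainClass : Type _ := Chain₁ M ⧸ boundaries₁ M

/-- The class modulo boundaries of a singular 1-simplex. -/
def pathClass (γ : unitInterval → M) : ChainClass M :=
  (boundaries₁ M).mkQ (Finsupp.single γ 1)

theorem mkQ_boundary₂ {D : Chain₂ M} (hD : D ∈ smoothChain₂ M) :
    (boundaries₁ M).mkQ (boundary₂ M D) = 0 := by
  rw [Submodule.mkQ_apply, Submodule.Quotient.mk_eq_zero]
  exact Submodule.mem_map_of_mem hD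

theorem pathClass_triangle {σ : ℝ × ℝ → M}
    (hσ : ContMDiffOn 𝓘(ℝ, ℝ × ℝ) (𝓡 2) 1 σ triangle) :
    pathClass (fun t : unitInterval ↦ σ (1 - t, t)) - pathClass (fun t : unitInterval ↦ σ (0, t))
      + pathClass (fun t : unitInterval ↦ σ (t, 0)) = 0 := by
  have h := mkQ_boundary₂ (Finsupp.single_mem_supported ℤ (1 : ℤ)
    (s := {σ | ContMDiffOn 𝓘(ℝ, ℝ × ℝ) (𝓡 2) 1 σ triangle}) hσ)
  rw [boundary₂_single, one_smul, map_add, map_sub] at h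
  exact h

theorem pathClass_square {K : ℝ × ℝ → M}
    (hK : ContMDiffOn 𝓘(ℝ, ℝ × ℝ) (𝓡 2) 1 K (Set.Icc 0 1 ×ˢ Set.Icc 0 1)) :
    pathClass (fun t : unitInterval ↦ K (t, 1)) - pathClass (fun t : unitInterval ↦ K (t, 0))
      + pathClass (fun t : unitInterval ↦ K (0, t))
      - pathClass (fun t : unitInterval ↦ K (1, t)) = 0 := by
  have h := mkQ_boundary₂ (squareChain_mem_smoothChain₂ hK)
  rw [boundary₂_squareChain, map_sub, map_add, map_sub] at h
  exact h

/-- The piece of the curve `c` between the parameters `a` and `b`. -/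
def subpath (c : ℝ → M) (a b : ℝ) (t : unitInterval) : M := c (a + t * (b - a))

omit [TopologicalSpace M] [ChartedSpace Plane M] in
theorem subpath_zero_one (c : ℝ → M) : subpath c 0 1 = fun t : unitInterval ↦ c t := by
  funext t; simp [subpath]

/-- The three pieces are the faces of a degenerate triangle: the affine map to the line with
vertices a, b, d, followed by c. No order of a, b, d is assumed. -/
theorem pathClass_subpath_add {c : ℝ → M} {S : Set ℝ} (hS : Convex ℝ S)
    (hc : ContMDiffOn 𝓘(ℝ, ℝ) (𝓡 2) 1 c S) {a b d : ℝ} (ha : a ∈ S) (hb : b ∈ S) (hd : d ∈ S) :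
    pathClass (subpath c a b) + pathClass (subpath c b d) = pathClass (subpath c a d) := by
  have h := pathClass_triangle (σ := fun p : ℝ × ℝ ↦ c (a + p.1 * (b - a) + p.2 * (d - a))) (by
    refine hc.comp (f := fun p : ℝ × ℝ ↦ a + p.1 * (b - a) + p.2 * (d - a))
      (ContDiff.contMDiff (by fun_prop)).contMDiffOn ?_
    rintro ⟨x, y⟩ ⟨hx, hy, hxy⟩
    simp only at hx hy hxy
    have h3 : (1 - x - y) • a + x • b + y • d ∈ S := by
      have := hS.sum_mem (t := Finset.univ) (w := ![1 - x - y, x, y]) (z := ![a, b, d])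
        (by intro i _; fin_cases i <;> simp <;> linarith) (by simp [Fin.sum_univ_three]; ring)
        (by intro i _; fin_cases i <;> simpa)
      simpa [Fin.sum_univ_three] using this
    change a + x * (b - a) + y * (d - a) ∈ S
    rw [show a + x * (b - a) + y * (d - a) = (1 - x - y) • a + x • b + y • d by
      simp only [smul_eq_mul]; ring]
    exact h3)
  have e1 : (fun t : unitInterval ↦ c (a + (1 - (t : ℝ)) * (b - a) + t * (d - a))) =
      subpath c b d := by
    funext t; simp only [subpath]; congr 1; ring
  have e2 : (fun t : unitInterval ↦ c (a + 0 * (b - a) + (t : ℝ) * (d - a))) = subpath c a d := by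
    funext t; simp only [subpath]; congr 1; ring
  have e3 : (fun t : unitInterval ↦ c (a + (t : ℝ) * (b - a) + 0 * (d - a))) = subpath c a b := by
    funext t; simp only [subpath]; congr 1; ring
  simp only [e1, e2, e3] at h
  rw [← sub_eq_zero, ← h]
  abel

theorem pathClass_const (x : M) : pathClass (fun _ ↦ x) = 0 := by
  have h := pathClass_subpath_add (c := fun _ ↦ x) convex_univ contMDiffOn_const
    (Set.mem_univ 0) (Set.mem_univ 0) (Set.mem_univ 0)
  have e : subpath (fun _ : ℝ ↦ x) 0 0 = fun _ ↦ x := rfl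
  rwa [e, add_eq_left] at h

theorem sum_pathClass_subpath {c : ℝ → M} {S : Set ℝ} (hS : Convex ℝ S)
    (hc : ContMDiffOn 𝓘(ℝ, ℝ) (𝓡 2) 1 c S) (s : ℕ → ℝ) (n : ℕ) (hs : ∀ i ≤ n, s i ∈ S) :
    ∑ i ∈ Finset.range n, pathClass (subpath c (s i) (s (i + 1))) =
      pathClass (subpath c (s 0) (s n)) := by
  induction n with
  | zero =>
    have : subpath c (s 0) (s 0) = fun _ ↦ c (s 0) := by funext t; simp [subpath]
    rw [Finset.sum_range_zero, this, pathClass_const]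
  | succ n ih =>
    rw [Finset.sum_range_succ, ih fun i hi ↦ hs i (hi.trans n.le_succ)]
    exact pathClass_subpath_add hS hc (hs 0 (Nat.zero_le _)) (hs n n.le_succ) (hs (n + 1) le_rfl)

theorem exists_chartBall_radius (x : M) : ∃ r > 0, Metric.ball (chartAt Plane x x) r ⊆
    (chartAt Plane x).target :=
  Metric.isOpen_iff.1 (chartAt Plane x).open_target _
    ((chartAt Plane x).map_source (mem_chart_source Plane x))

/-- A neighbourhood of `x` that is a round ball in the preferred chart at `x`. -/
def chartBall (x : M) : Set M :=
  (chartAt Plane x).source ∩ chartAt Plane x ⁻¹'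
    Metric.ball (chartAt Plane x x) (exists_chartBall_radius x).choose

theorem isOpen_chartBall (x : M) : IsOpen (chartBall x) :=
  (chartAt Plane x).isOpen_inter_preimage Metric.isOpen_ball

theorem mem_chartBall (x : M) : x ∈ chartBall x :=
  ⟨mem_chart_source Plane x, Metric.mem_ball_self (exists_chartBall_radius x).choose_spec.1⟩

theorem chartBall_subset_source (x : M) : chartBall x ⊆ (chartAt Plane x).source :=
  Set.inter_subset_left

/-- The straight path, in the chart at `x`, from `p` to `x`. -/
def radialPath (x p : M) (t : unitInterval) : M :=
  (chartAt Plane x).symm (chartAt Plane x p + (t : ℝ) • (chartAt Plane x x - chartAt Plane x p))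

/-- Local potential: the class of the straight path from `x` to `p`. -/
def potential (x p : M) : ChainClass M := -pathClass (radialPath x p)

variable [IsManifold (𝓡 2) ∞ M]

/-- Coning the curve to the centre x in the chart gives a square with edges c, two radial paths and
a constant path, whose class is zero. The domain is a round ball so that the cone stays inside it.
-/
theorem pathClass_eq_potential_sub {c : ℝ → M}
    (hc : ContMDiffOn 𝓘(ℝ, ℝ) (𝓡 2) 1 c (Set.Icc 0 1)) {x : M}
    (hx : ∀ s ∈ Set.Icc (0 : ℝ) 1, c s ∈ chartBall x) :
    pathClass (fun t : unitInterval ↦ c t) = potential x (c 1) - potential x (c 0) := by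
  set e := chartAt Plane x with he
  set r := (exists_chartBall_radius x).choose
  let L : ℝ × ℝ → Plane := fun q ↦ e (c q.1) + q.2 • (e x - e (c q.1))
  have hL : ContMDiffOn 𝓘(ℝ, ℝ × ℝ) 𝓘(ℝ, Plane) 1 L (Set.Icc 0 1 ×ˢ Set.Icc 0 1) := by
    have h1 : ContMDiffOn 𝓘(ℝ, ℝ) 𝓘(ℝ, Plane) 1 (fun s ↦ e (c s)) (Set.Icc 0 1) :=
      ((contMDiffOn_chart (I := 𝓡 2) (n := ∞) (x := x)).of_le (by simp)).comp hc
        fun s hs ↦ chartBall_subset_source x (hx s hs)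
    have h2 : ContDiffOn ℝ 1 (fun q : ℝ × ℝ ↦ e (c q.1)) (Set.Icc 0 1 ×ˢ Set.Icc 0 1) :=
      (contMDiffOn_iff_contDiffOn.1 h1).comp contDiff_fst.contDiffOn fun q hq ↦ hq.1
    rw [contMDiffOn_iff_contDiffOn]
    exact h2.add (contDiff_snd.contDiffOn.smul (contDiffOn_const.sub h2))
  have hLball : ∀ q ∈ Set.Icc (0 : ℝ) 1 ×ˢ Set.Icc (0 : ℝ) 1, L q ∈ Metric.ball (e x) r := by
    intro q hq
    exact (convex_ball (e x) r).add_smul_sub_mem (hx _ hq.1).2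
      (Metric.mem_ball_self (exists_chartBall_radius x).choose_spec.1) hq.2
  have hK : ContMDiffOn 𝓘(ℝ, ℝ × ℝ) (𝓡 2) 1 (fun q ↦ e.symm (L q))
      (Set.Icc 0 1 ×ˢ Set.Icc 0 1) :=
    ((contMDiffOn_chart_symm (I := 𝓡 2) (n := ∞) (x := x)).of_le (by simp)).comp hL
      fun q hq ↦ (exists_chartBall_radius x).choose_spec.2 (hLball q hq)
  have h := pathClass_square hK
  have e1 : (fun t : unitInterval ↦ e.symm (L (t, 1))) = fun _ ↦ x := by
    funext t
    simp only [L, one_smul, add_sub_cancel]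
    exact e.left_inv (mem_chart_source Plane x)
  have e2 : (fun t : unitInterval ↦ e.symm (L (t, 0))) = fun t : unitInterval ↦ c t := by
    funext t
    simp only [L, zero_smul, add_zero]
    exact e.left_inv (hx t t.2).1
  rw [e1, e2, pathClass_const] at h
  change 0 - _ + pathClass (radialPath x (c 0)) - pathClass (radialPath x (c 1)) = 0 at h
  rw [potential, potential, eq_comm, ← sub_eq_zero, ← h]
  abel

theorem pathClass_subpath_eq {c : ℝ → M} {a b : ℝ} (hab : a ≤ b)
    (hc : ContMDiffOn 𝓘(ℝ, ℝ) (𝓡 2) 1 c (Set.Icc a b)) {x : M}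
    (hx : ∀ s ∈ Set.Icc a b, c s ∈ chartBall x) :
    pathClass (subpath c a b) = potential x (c b) - potential x (c a) := by
  have hmem : ∀ s ∈ Set.Icc (0 : ℝ) 1, a + s * (b - a) ∈ Set.Icc a b := fun s hs ↦
    ⟨by nlinarith [hs.1, hs.2], by nlinarith [hs.1, hs.2]⟩
  have h := pathClass_eq_potential_sub (c := fun s ↦ c (a + s * (b - a))) (x := x)
    (hc.comp (f := fun s : ℝ ↦ a + s * (b - a))
      (ContDiff.contMDiff (by fun_prop)).contMDiffOn hmem) fun s hs ↦ hx _ (hmem s hs)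
  simp only [one_mul, zero_mul, add_zero, add_sub_cancel] at h
  exact h

/-- A point q near p is joined to p by a segment in the chart that lies in both balls, and either
potential computes the class of that segment. No continuity of the potentials is involved. -/
theorem eventually_potential_sub_eq {x y p : M} (hx : p ∈ chartBall x) (hy : p ∈ chartBall y) :
    ∀ᶠ q in 𝓝 p, potential x q - potential y q = potential x p - potential y p := by
  set e := chartAt Plane x with he
  have hps : p ∈ e.source := hx.1
  have hW : e.symm ⁻¹' (chartBall x ∩ chartBall y) ∩ e.target ∈ 𝓝 (e p) := by
    refine Filter.inter_mem ?_ (e.open_target.mem_nhds (e.map_source hps))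
    refine (e.continuousAt_symm (e.map_source hps)).preimage_mem_nhds ?_
    rw [e.left_inv hps]
    exact ((isOpen_chartBall x).inter (isOpen_chartBall y)).mem_nhds ⟨hx, hy⟩
  obtain ⟨ε, hε, hball⟩ := Metric.mem_nhds_iff.1 hW
  filter_upwards [(e.continuousAt hps).preimage_mem_nhds (Metric.ball_mem_nhds _ hε),
    e.open_source.mem_nhds hps] with q hq hqs
  let c : ℝ → M := fun s ↦ e.symm (e p + s • (e q - e p))
  have hmem : ∀ s ∈ Set.Icc (0 : ℝ) 1, e p + s • (e q - e p) ∈ Metric.ball (e p) ε :=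
    fun s hs ↦ (convex_ball _ _).add_smul_sub_mem (Metric.mem_ball_self hε) hq hs
  have hc : ContMDiffOn 𝓘(ℝ, ℝ) (𝓡 2) 1 c (Set.Icc 0 1) :=
    ((contMDiffOn_chart_symm (I := 𝓡 2) (n := ∞) (x := x)).of_le (by simp)).comp
      (f := fun s : ℝ ↦ e p + s • (e q - e p))
      (ContDiff.contMDiff (by fun_prop)).contMDiffOn fun s hs ↦ (hball (hmem s hs)).2
  have h1 := pathClass_eq_potential_sub hc fun s hs ↦ (hball (hmem s hs)).1.1
  have h2 := pathClass_eq_potential_sub hc fun s hs ↦ (hball (hmem s hs)).1.2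
  have c0 : c 0 = p := by simp only [c, zero_smul, add_zero]; exact e.left_inv hps
  have c1 : c 1 = q := by simp only [c, one_smul, add_sub_cancel]; exact e.left_inv hqs
  rw [c0, c1] at h1 h2
  rw [sub_eq_sub_iff_sub_eq_sub, ← h1, ← h2]

/-- The difference of two local potentials is constant on connected sets. -/
theorem potential_sub_eq_of_isPreconnected {S : Set M} (hS : IsPreconnected S) {x y : M}
    (hx : S ⊆ chartBall x) (hy : S ⊆ chartBall y) {p q : M} (hp : p ∈ S) (hq : q ∈ S) :
    potential x q - potential x p = potential y q - potential y p := by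
  rw [sub_eq_sub_iff_sub_eq_sub]
  refine hS.induction₂ (fun p q ↦ potential x q - potential y q = potential x p - potential y p)
    (fun p hp ↦ (eventually_potential_sub_eq (hx hp) (hy hp)).filter_mono nhdsWithin_le_nhds)
    (fun _ _ _ _ _ _ h1 h2 ↦ h2.trans h1) (fun _ _ _ _ h ↦ h.symm) hp hq

/-- **Homotopy invariance**: `C^1` closed curves that are freely homotopic through continuous
closed curves are homologous. -/
theorem pathClass_eq_of_homotopic {K : ℝ × ℝ → M} (hK : Continuous K)
    (hloop : ∀ t ∈ Set.Icc (0 : ℝ) 1, K (0, t) = K (1, t))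
    (h0 : ContMDiffOn 𝓘(ℝ, ℝ) (𝓡 2) 1 (fun s ↦ K (s, 0)) (Set.Icc 0 1))
    (h1 : ContMDiffOn 𝓘(ℝ, ℝ) (𝓡 2) 1 (fun s ↦ K (s, 1)) (Set.Icc 0 1)) :
    pathClass (fun t : unitInterval ↦ K (t, 0)) = pathClass (fun t : unitInterval ↦ K (t, 1)) := by
  -- The homotopy is only continuous, so its small squares are not C^1 simplices. It enters through
  -- the values of local potentials at grid points; smoothness is used on the first and the last row
  -- alone.
  obtain ⟨δ, hδ, hleb⟩ := lebesgue_number_lemma_of_metric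
    (s := Set.Icc (0 : ℝ) 1 ×ˢ Set.Icc (0 : ℝ) 1) (c := fun x : M ↦ K ⁻¹' chartBall x)
    (isCompact_Icc.prod isCompact_Icc) (fun x ↦ (isOpen_chartBall x).preimage hK)
    (fun p _ ↦ Set.mem_iUnion.2 ⟨K p, mem_chartBall _⟩)
  obtain ⟨m, hm⟩ := exists_nat_one_div_lt hδ
  set n := m + 1 with hn
  let s : ℕ → ℝ := fun i ↦ i / n
  have hn0 : (0 : ℝ) < n := by positivity
  have hs_mem : ∀ i ≤ n, s i ∈ Set.Icc (0 : ℝ) 1 := fun i hi ↦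
    ⟨by positivity, (div_le_one hn0).2 (by exact_mod_cast hi)⟩
  have hs_succ : ∀ i, s (i + 1) = s i + 1 / n := fun i ↦ by simp only [s]; push_cast; ring
  have hs_le : ∀ i, s i ≤ s (i + 1) := fun i ↦ by rw [hs_succ]; simp
  have hs0 : s 0 = 0 := by simp [s]
  have hsn : s n = 1 := div_self hn0.ne'
  have hbox : ∀ i j, ∃ x : M, i < n → j < n → ∀ p ∈ Set.Icc (s i) (s (i + 1)) ×ˢ
      Set.Icc (s j) (s (j + 1)), K p ∈ chartBall x := by
    intro i j
    by_cases hij : i < n ∧ j < n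
    · obtain ⟨x, hx⟩ := hleb (s i, s j) ⟨hs_mem i hij.1.le, hs_mem j hij.2.le⟩
      refine ⟨x, fun _ _ p hp ↦ hx ?_⟩
      have hlt : 1 / (n : ℝ) < δ := by rw [hn]; exact_mod_cast hm
      rw [Metric.mem_ball, Prod.dist_eq, max_lt_iff, Real.dist_eq, Real.dist_eq, abs_lt, abs_lt]
      obtain ⟨⟨a1, a2⟩, b1, b2⟩ := hp
      rw [hs_succ] at a2 b2
      exact ⟨⟨by linarith, by linarith⟩, by linarith, by linarith⟩
    · exact ⟨K 0, fun h h' ↦ absurd ⟨h, h'⟩ hij⟩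
  choose k hk using hbox
  -- the class of the `j'`-th row computed with the potentials of the `j`-th row of boxes
  let T : ℕ → ℕ → ChainClass M := fun j j' ↦ ∑ i ∈ Finset.range n,
    (potential (k i j) (K (s (i + 1), s j')) - potential (k i j) (K (s i, s j')))
  have hvert : ∀ (a : ℝ) (j : ℕ) (x y : M),
      (∀ t ∈ Set.Icc (s j) (s (j + 1)), K (a, t) ∈ chartBall x) →
      (∀ t ∈ Set.Icc (s j) (s (j + 1)), K (a, t) ∈ chartBall y) →
      potential x (K (a, s (j + 1))) - potential x (K (a, s j)) =
        potential y (K (a, s (j + 1))) - potential y (K (a, s j)) := by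
    intro a j x y hx hy
    have hpre : IsPreconnected ((fun t ↦ K (a, t)) '' Set.Icc (s j) (s (j + 1))) :=
      isPreconnected_Icc.image _ (hK.comp (by fun_prop)).continuousOn
    exact potential_sub_eq_of_isPreconnected hpre (Set.image_subset_iff.2 hx)
      (Set.image_subset_iff.2 hy) ⟨s j, Set.left_mem_Icc.2 (hs_le j), rfl⟩
      ⟨s (j + 1), Set.right_mem_Icc.2 (hs_le j), rfl⟩
  have hT1 : ∀ j < n, T j (j + 1) = T j j := by
    intro j hj
    -- The differences along vertical edges telescope around the loop. The index modulo n makes the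
    -- last edge use box 0, which is legitimate because K(0, t) = K(1, t).
    let d : ℕ → ChainClass M := fun i ↦ potential (k (i % n) j) (K (s i, s (j + 1))) -
      potential (k (i % n) j) (K (s i, s j))
    have hd : ∀ i < n, (potential (k i j) (K (s (i + 1), s (j + 1))) -
        potential (k i j) (K (s i, s (j + 1)))) - (potential (k i j) (K (s (i + 1), s j)) -
        potential (k i j) (K (s i, s j))) = d (i + 1) - d i := by
      intro i hi
      have e1 : d i = potential (k i j) (K (s i, s (j + 1))) - potential (k i j) (K (s i, s j)) := by
        simp only [d, Nat.mod_eq_of_lt hi]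
      have e2 : d (i + 1) = potential (k i j) (K (s (i + 1), s (j + 1))) -
          potential (k i j) (K (s (i + 1), s j)) := by
        refine hvert _ _ _ _ ?_ fun t ht ↦ hk i j hi hj _ ⟨Set.right_mem_Icc.2 (hs_le i), ht⟩
        intro t ht
        rcases Nat.lt_or_ge (i + 1) n with hi' | hi'
        · rw [Nat.mod_eq_of_lt hi']
          exact hk (i + 1) j hi' hj _ ⟨Set.left_mem_Icc.2 (hs_le _), ht⟩
        · have hin : i + 1 = n := le_antisymm hi hi'
          have ht' : t ∈ Set.Icc (0 : ℝ) 1 :=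
            ⟨(hs_mem j hj.le).1.trans ht.1, ht.2.trans (hs_mem (j + 1) hj).2⟩
          rw [hin, Nat.mod_self, hsn, ← hloop t ht', ← hs0]
          exact hk 0 j (Nat.succ_pos m) hj _ ⟨Set.left_mem_Icc.2 (hs_le 0), ht⟩
      rw [e1, e2]
      abel
    rw [← sub_eq_zero]
    simp only [T]
    rw [← Finset.sum_sub_distrib, Finset.sum_congr rfl fun i hi ↦ hd i (Finset.mem_range.1 hi),
      Finset.sum_range_sub]
    have hj1 := hs_mem (j + 1) hj
    have hj0 := hs_mem j hj.le
    simp only [d, Nat.mod_self, Nat.zero_mod, hsn, hs0, hloop _ hj1, hloop _ hj0, sub_self]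
  have hT2 : ∀ j, j + 1 < n → T j (j + 1) = T (j + 1) (j + 1) := by
    intro j hj
    refine Finset.sum_congr rfl fun i hi ↦ ?_
    have hi := Finset.mem_range.1 hi
    -- This edge belongs to boxes of both rows, and on its connected image their potentials differ
    -- by a constant.
    have hpre : IsPreconnected ((fun a ↦ K (a, s (j + 1))) '' Set.Icc (s i) (s (i + 1))) :=
      isPreconnected_Icc.image _ (hK.comp (by fun_prop)).continuousOn
    exact potential_sub_eq_of_isPreconnected hpre
      (Set.image_subset_iff.2 fun a ha ↦ hk i j hi (j.lt_succ_self.trans hj) _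
        ⟨ha, Set.right_mem_Icc.2 (hs_le j)⟩)
      (Set.image_subset_iff.2 fun a ha ↦ hk i (j + 1) hi hj _
        ⟨ha, Set.left_mem_Icc.2 (hs_le (j + 1))⟩)
      ⟨s i, Set.left_mem_Icc.2 (hs_le i), rfl⟩ ⟨s (i + 1), Set.right_mem_Icc.2 (hs_le i), rfl⟩
  have hT3 : ∀ j < n, T j j = T 0 0 := by
    intro j
    induction j with
    | zero => intro _; rfl
    | succ j ih =>
      intro hj
      rw [← hT2 j hj, hT1 j (j.lt_succ_self.trans hj), ih (j.lt_succ_self.trans hj)]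
  have hrow : ∀ j < n, ∀ j', s j' ∈ Set.Icc (s j) (s (j + 1)) →
      ContMDiffOn 𝓘(ℝ, ℝ) (𝓡 2) 1 (fun a ↦ K (a, s j')) (Set.Icc 0 1) →
      T j j' = pathClass (fun t : unitInterval ↦ K (t, s j')) := by
    intro j hj j' hj' hc
    have h := sum_pathClass_subpath (convex_Icc 0 1) hc s n hs_mem
    rw [hs0, hsn, subpath_zero_one] at h
    rw [← h]
    refine Finset.sum_congr rfl fun i hi ↦ ?_
    have hi := Finset.mem_range.1 hi
    refine (pathClass_subpath_eq (hs_le i) (hc.mono ?_) fun a ha ↦ hk i j hi hj _ ⟨ha, hj'⟩).symm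
    exact Set.Icc_subset_Icc (hs_mem i hi.le).1 (hs_mem (i + 1) hi).2
  have hr0 := hrow 0 (Nat.succ_pos m) 0 (Set.left_mem_Icc.2 (hs_le 0)) (by rwa [hs0])
  have hr1 := hrow m m.lt_succ_self n (Set.right_mem_Icc.2 (hs_le m)) (by rwa [hsn])
  rw [hs0] at hr0
  rw [hsn] at hr1
  rw [← hr0, ← hr1, ← hT3 m m.lt_succ_self, ← hT1 m m.lt_succ_self]

end Homology

/-! ### Smooth closed 1-forms with prescribed periods -/

section SmoothPotentials

variable {M : Type*} [TopologicalSpace M] [ChartedSpace Plane M] [IsManifold (𝓡 2) ∞ M]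

/-- Smooth local primitives of a closed 1-form whose periods are given by the cocycle `c`; the
0-cochain `correction` relates them to the local potentials of `c`. -/
structure SmoothPotential (c : ChainClass M →+ ℝ) where
  toFun : M → M → ℝ
  correction : M → ℝ
  contMDiffOn (x : M) : ContMDiffOn (𝓡 2) 𝓘(ℝ, ℝ) ∞ (toFun x) (chartBall x)
  eq_sub (x p : M) : toFun x p = c (potential x p) - correction p

/-- **De Rham's theorem in degree one** (surjectivity): every real 1-cocycle is cohomologous to
the integration of a smooth closed 1-form. -/
theorem nonempty_smoothPotential [T2Space M] [CompactSpace M] (c : ChainClass M →+ ℝ) :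
    Nonempty (SmoothPotential c) := by
  obtain ⟨χ, hχ⟩ := SmoothPartitionOfUnity.exists_isSubordinate (𝓡 2) (isClosed_univ (X := M))
    (chartBall (M := M)) isOpen_chartBall fun x _ ↦ Set.mem_iUnion.2 ⟨x, mem_chartBall x⟩
  -- Neither term of the difference need be continuous, but the difference is locally constant where
  -- both are defined, so the weighted sum is smooth. The discarded part does not depend on x and
  -- becomes the correction.
  refine ⟨⟨fun x p ↦ ∑ᶠ k, χ k p • (c (potential x p) - c (potential k p)),
    fun p ↦ ∑ᶠ k, χ k p • c (potential k p), fun x p hp ↦ ?_, fun x p ↦ ?_⟩⟩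
  · refine (χ.contMDiffAt_finsum fun k hk ↦ ?_).contMDiffWithinAt
    refine (contMDiffAt_const (c := c (potential x p) - c (potential k p))).congr_of_eventuallyEq ?_
    filter_upwards [eventually_potential_sub_eq hp (hχ k hk)] with q hq
    rw [← map_sub, ← map_sub, hq]
  · rw [← χ.sum_finsupport_smul_eq_finsum p (fun k p ↦ c (potential x p) - c (potential k p)),
      ← χ.sum_finsupport_smul_eq_finsum p (fun k p ↦ c (potential k p))]
    simp only [smul_sub, Finset.sum_sub_distrib]
    rw [← Finset.sum_smul, χ.sum_finsupport p (Set.mem_univ p), one_smul]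

namespace SmoothPotential

variable {c : ChainClass M →+ ℝ} (u : SmoothPotential c)

/-- The closed 1-form given by smooth local potentials. -/
def form (p : M) : TangentSpace (𝓡 2) p →L[ℝ] ℝ := mfderiv (𝓡 2) 𝓘(ℝ, ℝ) (u.toFun p) p

omit [IsManifold (𝓡 2) ∞ M] in
theorem mdifferentiableAt {x p : M} (hp : p ∈ chartBall x) :
    MDifferentiableAt (𝓡 2) 𝓘(ℝ, ℝ) (u.toFun x) p :=
  ((u.contMDiffOn x).contMDiffAt ((isOpen_chartBall x).mem_nhds hp)).mdifferentiableAt (by simp)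

/-- Two smooth potentials differ locally by a constant, so the form, defined at p by the potential
centred at p, is the differential of each of them. -/
theorem hasMFDerivAt {x p : M} (hp : p ∈ chartBall x) :
    HasMFDerivAt (𝓡 2) 𝓘(ℝ, ℝ) (u.toFun x) p (u.form p) := by
  have h1 : ∀ᶠ q in 𝓝 p, u.toFun x q = u.toFun p q + (u.toFun x p - u.toFun p p) := by
    filter_upwards [eventually_potential_sub_eq hp (mem_chartBall p)] with q hq
    have := congrArg c hq
    simp only [map_sub] at this
    simp only [u.eq_sub]
    linarith
  have h2 := (u.mdifferentiableAt (mem_chartBall p)).hasMFDerivAt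
  have h3 : HasMFDerivAt (𝓡 2) 𝓘(ℝ, ℝ) (fun q ↦ u.toFun p q + (u.toFun x p - u.toFun p p)) p
      (u.form p) := by
    exact (h2.add (hasMFDerivAt_const (I := 𝓡 2) (I' := 𝓘(ℝ, ℝ))
      (u.toFun x p - u.toFun p p) p)).congr_mfderiv (add_zero (u.form p))
  exact h3.congr_of_eventuallyEq h1

/-- The primitive, along the curve `γ`, of the closed 1-form given by `u`. -/
def primitive (γ : ℝ → M) (s : ℝ) : ℝ := c (pathClass (subpath γ 0 s)) - u.correction (γ s)

omit [IsManifold (𝓡 2) ∞ M] in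
theorem primitive_one_sub_zero {γ : ℝ → M} (hγ : γ 0 = γ 1) :
    u.primitive γ 1 - u.primitive γ 0 = c (pathClass fun t : unitInterval ↦ γ t) := by
  have : subpath γ 0 0 = fun _ ↦ γ 0 := by funext t; simp [subpath]
  simp only [primitive, subpath_zero_one, this, pathClass_const, map_zero, hγ]
  ring

/-- Over a short piece of γ the class of the path is a difference of local potentials, and the
correction turns these into smooth ones. The regularity and the derivative of the primitive follow
from this. -/
theorem eventually_primitive_eq {γ : ℝ → M}
    (hγ : ContMDiffOn 𝓘(ℝ, ℝ) (𝓡 2) 1 γ (Set.Icc 0 1)) {s₀ : ℝ} (hs₀ : s₀ ∈ Set.Icc (0 : ℝ) 1) :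
    ∀ᶠ s in 𝓝[Set.Icc 0 1] s₀, u.primitive γ s =
      u.toFun (γ s₀) (γ s) + (u.primitive γ s₀ - u.toFun (γ s₀) (γ s₀)) := by
  have hnear := (hγ.continuousOn s₀ hs₀).preimage_mem_nhdsWithin
    ((isOpen_chartBall _).mem_nhds (mem_chartBall (γ s₀)))
  obtain ⟨ε, hε, hball⟩ := Metric.mem_nhdsWithin_iff.1 hnear
  have h0 : (0 : ℝ) ∈ Set.Icc (0 : ℝ) 1 := by simp
  filter_upwards [inter_mem_nhdsWithin _ (Metric.ball_mem_nhds s₀ hε)] with s hs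
  have hadd := pathClass_subpath_add (convex_Icc 0 1) hγ h0 hs₀ hs.1
  have hadd' := pathClass_subpath_add (convex_Icc 0 1) hγ h0 hs.1 hs₀
  have hin : ∀ τ ∈ segment ℝ s₀ s, γ τ ∈ chartBall (γ s₀) := fun τ hτ ↦
    hball ⟨(convex_ball s₀ ε).segment_subset (Metric.mem_ball_self hε) hs.2 hτ,
      (convex_Icc (0 : ℝ) 1).segment_subset hs₀ hs.1 hτ⟩
  have hkey : c (pathClass (subpath γ 0 s)) - c (pathClass (subpath γ 0 s₀)) =
      c (potential (γ s₀) (γ s)) - c (potential (γ s₀) (γ s₀)) := by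
    rcases le_total s₀ s with h | h
    · rw [segment_eq_Icc h] at hin
      have h1 := pathClass_subpath_eq h (hγ.mono (Set.Icc_subset_Icc hs₀.1 hs.1.2)) hin
      rw [← hadd, h1, map_add, map_sub]
      ring
    · rw [segment_symm, segment_eq_Icc h] at hin
      have h1 := pathClass_subpath_eq h (hγ.mono (Set.Icc_subset_Icc hs.1.1 hs₀.2)) hin
      rw [← hadd', h1, map_add, map_sub]
      ring
  simp only [primitive, u.eq_sub]
  linarith

theorem contDiffOn_primitive {γ : ℝ → M} (hγ : ContMDiffOn 𝓘(ℝ, ℝ) (𝓡 2) 1 γ (Set.Icc 0 1)) :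
    ContDiffOn ℝ 1 (u.primitive γ) (Set.Icc 0 1) := by
  intro s hs
  have h1 : ContMDiffWithinAt 𝓘(ℝ, ℝ) 𝓘(ℝ, ℝ) 1 (fun τ ↦ u.toFun (γ s) (γ τ)) (Set.Icc 0 1) s :=
    (((u.contMDiffOn (γ s)).contMDiffAt ((isOpen_chartBall _).mem_nhds (mem_chartBall _))).of_le
      (by simp)).comp_contMDiffWithinAt s (hγ s hs)
  refine ((contMDiffWithinAt_iff_contDiffWithinAt.1 h1).add
    contDiffWithinAt_const).congr_of_eventuallyEq_of_mem (u.eventually_primitive_eq hγ hs) hs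

theorem hasDerivAt_primitive {γ : ℝ → M} (hγ : ContMDiffOn 𝓘(ℝ, ℝ) (𝓡 2) 1 γ (Set.Icc 0 1))
    {s : ℝ} (hs : s ∈ Set.Ioo (0 : ℝ) 1) :
    HasDerivAt (u.primitive γ) (u.form (γ s) (mfderiv 𝓘(ℝ, ℝ) (𝓡 2) γ s (1 : ℝ))) s := by
  have hγs : MDifferentiableAt 𝓘(ℝ, ℝ) (𝓡 2) γ s :=
    (hγ.contMDiffAt (Icc_mem_nhds hs.1 hs.2)).mdifferentiableAt one_ne_zero
  have h1 : HasDerivAt (fun τ ↦ u.toFun (γ s) (γ τ))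
      (u.form (γ s) (mfderiv 𝓘(ℝ, ℝ) (𝓡 2) γ s (1 : ℝ))) s := by
    have h0 : HasFDerivAt (𝕜 := ℝ) (E := ℝ) (F := ℝ) (fun τ ↦ u.toFun (γ s) (γ τ))
        ((u.form (γ s)).comp (mfderiv 𝓘(ℝ, ℝ) (𝓡 2) γ s)) s := hasMFDerivAt_iff_hasFDerivAt.1
      ((u.hasMFDerivAt (mem_chartBall (γ s))).comp s hγs.hasMFDerivAt)
    exact h0.hasDerivAt
  refine (h1.add_const _).congr_of_eventuallyEq
    ((nhdsWithin_eq_nhds.2 (Icc_mem_nhds hs.1 hs.2)) ▸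
      u.eventually_primitive_eq hγ (Set.Ioo_subset_Icc_self hs))

end SmoothPotential

end SmoothPotentials

/-! ### Vector fields and the area form in coordinates -/

section Symplectic

variable {M : Type*} [TopologicalSpace M] [ChartedSpace Plane M] [IsManifold (𝓡 2) ∞ M]

/-- A vector field is smooth where its expression in a chart is. -/
theorem contMDiffAt_of_fieldInChart {X : (x : M) → TangentSpace (𝓡 2) x} {x₀ p : M}
    (hp : p ∈ (chartAt Plane x₀).source)
    (hX : ContDiffAt ℝ ∞ (fieldInChart X x₀) (chartAt Plane x₀ p)) :
    ContMDiffAt (𝓡 2) (𝓡 2).tangent ∞ (fun x ↦ (⟨x, X x⟩ : TangentBundle (𝓡 2) M)) p := by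
  refine ((trivializationAt Plane (TangentSpace (𝓡 2) : M → Type _)
    x₀).contMDiffAt_section_iff (IB := 𝓡 2) (n := ∞) (s := X) (by simpa using hp)).2 ?_
  have h1 : ContMDiffAt (𝓡 2) 𝓘(ℝ, Plane) ∞
      (fun q ↦ fieldInChart X x₀ (chartAt Plane x₀ q)) p :=
    (hX.contMDiffAt (x := chartAt Plane x₀ p)).comp p
      ((contMDiffOn_chart (I := 𝓡 2) (x := x₀)).contMDiffAt
        ((chartAt Plane x₀).open_source.mem_nhds hp))
  refine h1.congr_of_eventuallyEq ?_
  filter_upwards [(chartAt Plane x₀).open_source.mem_nhds hp] with q hq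
  rw [trivializationAt_apply_eq_mfderiv hq, fieldInChart]
  have : ∀ q' : M, q' = q → (mfderiv (𝓡 2) (𝓡 2) (chartAt Plane x₀) q (X q) : Plane) =
    mfderiv (𝓡 2) (𝓡 2) (chartAt Plane x₀) q' (X q') := by rintro _ rfl; rfl
  exact this _ ((chartAt Plane x₀).left_inv hq)

/-- The area form read in the chart at `x₀`. -/
def formInChart (Ω : AreaForm M) (x₀ : M) (y : Plane) : Plane →L[ℝ] Plane →L[ℝ] ℝ :=
  (ContinuousLinearMap.compL ℝ Plane Plane ℝ).flip
      (mfderiv (𝓡 2) (𝓡 2) (chartAt Plane x₀).symm y : Plane →L[ℝ] Plane) ∘L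
    (Ω.toFun ((chartAt Plane x₀).symm y) : Plane →L[ℝ] Plane →L[ℝ] ℝ) ∘L
      (mfderiv (𝓡 2) (𝓡 2) (chartAt Plane x₀).symm y : Plane →L[ℝ] Plane)

theorem formInChart_apply (Ω : AreaForm M) (x₀ : M) (y v w : Plane) :
    formInChart Ω x₀ y v w = Ω.toFun ((chartAt Plane x₀).symm y)
      (mfderiv (𝓡 2) (𝓡 2) (chartAt Plane x₀).symm y v)
      (mfderiv (𝓡 2) (𝓡 2) (chartAt Plane x₀).symm y w) := rfl

/-- The coefficients are the values of Ω on the coordinate fields of the chart, which are smooth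
because they are constant in that chart. -/
theorem contDiffOn_formInChart (Ω : AreaForm M) (x₀ : M) :
    ContDiffOn ℝ ∞ (formInChart Ω x₀) (chartAt Plane x₀).target := by
  rw [contDiffOn_clm_apply]
  intro v
  rw [contDiffOn_clm_apply]
  intro w
  set e := chartAt Plane x₀ with he
  let V : Plane → (p : M) → TangentSpace (𝓡 2) p := fun v p ↦
    mfderiv (𝓡 2) (𝓡 2) e.symm (e p) v
  have hV : ∀ (v : Plane) (p : M), p ∈ e.source → ContMDiffAt (𝓡 2) (𝓡 2).tangent ∞
      (fun x ↦ (⟨x, V v x⟩ : TangentBundle (𝓡 2) M)) p := by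
    intro v p hp
    refine contMDiffAt_of_fieldInChart hp ?_
    refine (contDiffAt_const (c := v)).congr_of_eventuallyEq ?_
    filter_upwards [e.open_target.mem_nhds (e.map_source hp)] with y hy
    have h2 : ∀ z : Plane, z = y → (mfderiv (𝓡 2) (𝓡 2) e.symm z v : Plane) =
      mfderiv (𝓡 2) (𝓡 2) e.symm y v := by rintro _ rfl; rfl
    have h3 := mfderiv_chart_mfderiv_chart_symm hy v
    exact (congrArg (fun a : Plane ↦ (mfderiv (𝓡 2) (𝓡 2) e (e.symm y) : Plane →L[ℝ] Plane) a)
      (h2 _ (e.right_inv hy))).trans h3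
  have hΩ : ContMDiffOn (𝓡 2) 𝓘(ℝ, ℝ) ∞ (fun p ↦ Ω.toFun p (V v p) (V w p)) e.source := by
    intro p hp
    have h : ContMDiffAt (𝓡 2) ((𝓡 2).prod 𝓘(ℝ, ℝ)) ∞ (fun p ↦ Bundle.TotalSpace.mk' ℝ
        (E := Bundle.Trivial M ℝ) p (Ω.toFun p (V v p) (V w p))) p :=
      ContMDiffAt.clm_bundle_apply₂ (F₁ := Plane) (F₂ := Plane) (Ω.contMDiff p)
        (hV v p hp) (hV w p hp)
    rw [Bundle.contMDiffAt_totalSpace] at h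
    exact h.2.contMDiffWithinAt
  have h1 := hΩ.comp (contMDiffOn_chart_symm (I := 𝓡 2) (n := ∞) (x := x₀))
    fun y hy ↦ e.map_target hy
  refine (contMDiffOn_iff_contDiffOn.1 h1).congr fun y hy ↦ ?_
  have h2 : ∀ z : Plane, z = y → ∀ v, (mfderiv (𝓡 2) (𝓡 2) e.symm z v : Plane) =
      mfderiv (𝓡 2) (𝓡 2) e.symm y v := by rintro _ rfl _; rfl
  have h3 : ∀ v, (V v (e.symm y) : Plane) = mfderiv (𝓡 2) (𝓡 2) e.symm y v :=
    fun v ↦ h2 _ (e.right_inv hy) v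
  simp only [Function.comp]
  rw [formInChart_apply]
  exact (congrArg₂ (fun a b : Plane ↦ (Ω.toFun (e.symm y) : Plane →L[ℝ] Plane →L[ℝ] ℝ) a b)
    (h3 v) (h3 w)).symm

end Symplectic

/-! ### Cartan's formula in the plane -/

section PlaneCalculus

/-- In coordinates, `s ↦ D(G_s)` has derivative `DX` at `0` if `X` is the initial velocity of the
family `G_s` of maps. -/
theorem hasDerivAt_fderiv_of_initial_velocity {E : Type*} [NormedAddCommGroup E] [NormedSpace ℝ E]
    {G : ℝ × E → E} {y₀ : E} (hG : ContDiffAt ℝ 2 G (0, y₀)) {X : E → E}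
    (hX : ∀ᶠ y in 𝓝 y₀, HasDerivAt (fun s ↦ G (s, y)) (X y) 0) :
    HasDerivAt (fun s ↦ fderiv ℝ (fun y ↦ G (s, y)) y₀) (fderiv ℝ X y₀) 0 := by
  have hdiff : ∀ᶠ p in 𝓝 ((0 : ℝ), y₀), DifferentiableAt ℝ G p := by
    filter_upwards [hG.eventually (by simp)] with p hp
    exact hp.differentiableAt two_ne_zero
  have hD : HasFDerivAt (fderiv ℝ G) (fderiv ℝ (fderiv ℝ G) (0, y₀)) (0, y₀) :=
    ((hG.fderiv_right (m := 1) (by norm_num)).differentiableAt one_ne_zero).hasFDerivAt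
  set D' := fderiv ℝ (fderiv ℝ G) ((0 : ℝ), y₀) with hD'
  -- Symmetry of the second derivative is what exchanges the derivative in time with the derivative
  -- in space.
  have hsymm : ∀ a b, D' a b = D' b a := by
    intro a b
    exact (hG.isSymmSndFDerivAt (by simp)).eq a b
  have hXd : HasFDerivAt X ((ContinuousLinearMap.apply ℝ E ((1 : ℝ), (0 : E))) ∘L
      D' ∘L ContinuousLinearMap.inr ℝ ℝ E) y₀ := by
    have h1 : HasFDerivAt (fun y ↦ fderiv ℝ G (0, y) ((1 : ℝ), (0 : E)))
        ((ContinuousLinearMap.apply ℝ E ((1 : ℝ), (0 : E))) ∘L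
        D' ∘L ContinuousLinearMap.inr ℝ ℝ E) y₀ :=
      (ContinuousLinearMap.apply ℝ E ((1 : ℝ), (0 : E))).hasFDerivAt.comp y₀
        (hD.comp y₀ (hasFDerivAt_prodMk_right 0 y₀))
    refine h1.congr_of_eventuallyEq ?_
    have hc : ContinuousAt (fun y : E ↦ ((0 : ℝ), y)) y₀ := by fun_prop
    filter_upwards [hX, hc.eventually hdiff] with y hy hy'
    have h2 : HasDerivAt (fun s ↦ G (s, y)) (fderiv ℝ G (0, y) ((1 : ℝ), (0 : E))) 0 :=
      hy'.hasFDerivAt.comp_hasDerivAt (0 : ℝ) ((hasDerivAt_id (0 : ℝ)).prodMk (hasDerivAt_const _ y))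
    exact hy.unique h2
  have hc : ContinuousAt (fun s : ℝ ↦ (s, y₀)) 0 := by fun_prop
  have h3 : (fun s ↦ fderiv ℝ (fun y ↦ G (s, y)) y₀) =ᶠ[𝓝 0]
      fun s ↦ fderiv ℝ G (s, y₀) ∘L ContinuousLinearMap.inr ℝ ℝ E := by
    filter_upwards [hc.eventually hdiff] with s hs
    exact (hs.hasFDerivAt.comp y₀ (hasFDerivAt_prodMk_right s y₀)).fderiv
  refine HasDerivAt.congr_of_eventuallyEq ?_ h3
  have h4 : HasDerivAt (fun s : ℝ ↦ fderiv ℝ G (s, y₀)) (D' ((1 : ℝ), (0 : E))) 0 :=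
    hD.comp_hasDerivAt (0 : ℝ) ((hasDerivAt_id (0 : ℝ)).prodMk (hasDerivAt_const _ y₀))
  have h5 := ((ContinuousLinearMap.compL ℝ E (ℝ × E) E).flip
    (ContinuousLinearMap.inr ℝ ℝ E)).hasFDerivAt.comp_hasDerivAt (0 : ℝ) h4
  refine h5.congr_deriv ?_
  rw [hXd.fderiv]
  ext v
  simp [hsymm ((1 : ℝ), (0 : E)) (0, v)]

theorem plane_decomp (v : Plane) :
    v = v 0 • EuclideanSpace.single 0 (1 : ℝ) + v 1 • EuclideanSpace.single 1 (1 : ℝ) := by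
  ext i; fin_cases i <;> simp

theorem alternating_apply_eq {B : Plane →L[ℝ] Plane →L[ℝ] ℝ} (hB : ∀ v, B v v = 0) (v w : Plane) :
    B v w = B (EuclideanSpace.single 0 1) (EuclideanSpace.single 1 1) *
      (v 0 * w 1 - v 1 * w 0) := by
  have hanti : B (EuclideanSpace.single 1 1) (EuclideanSpace.single 0 1) =
      -B (EuclideanSpace.single 0 1) (EuclideanSpace.single 1 1) := by
    have h := hB (EuclideanSpace.single 0 1 + EuclideanSpace.single 1 1)
    simp only [map_add, add_apply, hB] at h
    linarith
  conv_lhs => rw [plane_decomp v, plane_decomp w]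
  simp only [map_add, map_smul, add_apply, smul_apply, hB, hanti, smul_eq_mul]
  ring

/-- The infinitesimal form of the invariance of an area form under the flow of a vector field that
is dual to a closed 1-form. -/
theorem lieDerivative_eq_zero {B : Plane → Plane →L[ℝ] Plane →L[ℝ] ℝ} {X : Plane → Plane}
    {h : Plane → ℝ} {y₀ : Plane} (hB : DifferentiableAt ℝ B y₀)
    (halt : ∀ᶠ y in 𝓝 y₀, ∀ v, B y v v = 0) (hX : DifferentiableAt ℝ X y₀)
    (hh : ContDiffAt ℝ 2 h y₀) (hBX : ∀ᶠ y in 𝓝 y₀, B y (X y) = fderiv ℝ h y) (v w : Plane) :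
    fderiv ℝ B y₀ (X y₀) v w + B y₀ (fderiv ℝ X y₀ v) w + B y₀ v (fderiv ℝ X y₀ w) = 0 := by
  have hDalt : ∀ z v, fderiv ℝ B y₀ z v v = 0 := by
    intro z v
    have h1 := (hB.hasFDerivAt.clm_apply (hasFDerivAt_const v y₀)).clm_apply
      (hasFDerivAt_const v y₀)
    have h2 : HasFDerivAt (fun y ↦ B y v v) 0 y₀ :=
      (hasFDerivAt_const (𝕜 := ℝ) (0 : ℝ) y₀).congr_of_eventuallyEq (by
        filter_upwards [halt] with y hy using hy v)
    have h3 := congrArg (fun A ↦ A z) (h1.unique h2)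
    simpa using h3
  have hsymm : ∀ a b, fderiv ℝ (fderiv ℝ h) y₀ a b = fderiv ℝ (fderiv ℝ h) y₀ b a :=
    fun a b ↦ (hh.isSymmSndFDerivAt (by simp)).eq a b
  -- Differentiating B(X) = dh; symmetry of the Hessian of h then says that B(X) is closed.
  have hprod : ∀ a b, fderiv ℝ B y₀ a (X y₀) b + B y₀ (fderiv ℝ X y₀ a) b =
      fderiv ℝ (fderiv ℝ h) y₀ a b := by
    intro a b
    have h1 := hB.hasFDerivAt.clm_apply hX.hasFDerivAt
    have h2 : HasFDerivAt (fun y ↦ B y (X y)) (fderiv ℝ (fderiv ℝ h) y₀) y₀ :=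
      (((hh.fderiv_right (m := 1) (by norm_num)).differentiableAt
        one_ne_zero).hasFDerivAt).congr_of_eventuallyEq hBX
    have h3 := congrArg (fun A ↦ A a b) (h1.unique h2)
    simp at h3
    linarith
  have halt0 := halt.self_of_nhds
  have hanti : B y₀ v (fderiv ℝ X y₀ w) = -B y₀ (fderiv ℝ X y₀ w) v := by
    rw [alternating_apply_eq halt0, alternating_apply_eq halt0 (fderiv ℝ X y₀ w)]
    ring
  have hlin : ∀ z, fderiv ℝ B y₀ z (EuclideanSpace.single 0 1) (EuclideanSpace.single 1 1) =
      z 0 * fderiv ℝ B y₀ (EuclideanSpace.single 0 1) (EuclideanSpace.single 0 1)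
        (EuclideanSpace.single 1 1) +
      z 1 * fderiv ℝ B y₀ (EuclideanSpace.single 1 1) (EuclideanSpace.single 0 1)
        (EuclideanSpace.single 1 1) := by
    intro z
    conv_lhs => rw [plane_decomp z]
    simp
  have e1 := hprod v w
  have e2 := hprod w v
  have e3 := hsymm v w
  have c1 := alternating_apply_eq (hDalt (X y₀)) v w
  have c2 := alternating_apply_eq (hDalt v) (X y₀) w
  have c3 := alternating_apply_eq (hDalt w) (X y₀) v
  rw [hlin] at c1 c2 c3
  rw [hanti]
  -- This is dB(X, v, w) = 0: a 3-form on the plane vanishes.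
  have : fderiv ℝ B y₀ (X y₀) v w - fderiv ℝ B y₀ v (X y₀) w + fderiv ℝ B y₀ w (X y₀) v = 0 := by
    rw [c1, c2, c3]
    ring
  linarith

end PlaneCalculus

/-! ### The vector field dual to a closed 1-form -/

section DualField

/-- A nondegenerate bilinear form on the plane, as an isomorphism onto the dual space. -/
theorem exists_equiv_of_nondegenerate {B : Plane →L[ℝ] Plane →L[ℝ] ℝ}
    (hB : ∀ v, v ≠ 0 → ∃ w, B v w ≠ 0) :
    ∃ e : Plane ≃L[ℝ] (Plane →L[ℝ] ℝ), (e : Plane →L[ℝ] Plane →L[ℝ] ℝ) = B := by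
  have hinj : Function.Injective (B : Plane →ₗ[ℝ] Plane →L[ℝ] ℝ) := by
    rw [← LinearMap.ker_eq_bot, LinearMap.ker_eq_bot']
    intro v hv
    by_contra hv0
    obtain ⟨w, hw⟩ := hB v hv0
    exact hw (congrArg (fun A : Plane →L[ℝ] ℝ ↦ A w) hv)
  have hfin : Module.finrank ℝ Plane = Module.finrank ℝ (Plane →L[ℝ] ℝ) := by
    rw [← (LinearMap.toContinuousLinearMap (𝕜 := ℝ) (E := Plane) (F' := ℝ)).finrank_eq,
      Module.finrank_linearMap, Module.finrank_self, mul_one]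
  refine ⟨(LinearEquiv.ofInjectiveOfFinrankEq _ hinj hfin).toContinuousLinearEquiv, ?_⟩
  ext v w
  rfl

theorem apply_inverse_of_nondegenerate {B : Plane →L[ℝ] Plane →L[ℝ] ℝ}
    (hB : ∀ v, v ≠ 0 → ∃ w, B v w ≠ 0) (a : Plane →L[ℝ] ℝ) : B (B.inverse a) = a := by
  obtain ⟨e, rfl⟩ := exists_equiv_of_nondegenerate hB
  rw [ContinuousLinearMap.inverse_equiv]
  exact e.apply_symm_apply _

variable {M : Type*} [TopologicalSpace M] [ChartedSpace Plane M] [IsManifold (𝓡 2) ∞ M]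

/-- The vector field `X` with `Ω(X, ·) = α`. -/
def dualField (Ω : AreaForm M) (α : (p : M) → TangentSpace (𝓡 2) p →L[ℝ] ℝ) (p : M) :
    TangentSpace (𝓡 2) p :=
  ContinuousLinearMap.inverse (Ω.toFun p : Plane →L[ℝ] Plane →L[ℝ] ℝ) (α p : Plane →L[ℝ] ℝ)

theorem apply_dualField (Ω : AreaForm M) (α : (p : M) → TangentSpace (𝓡 2) p →L[ℝ] ℝ) (p : M) :
    Ω.toFun p (dualField Ω α p) = α p :=
  apply_inverse_of_nondegenerate (B := (Ω.toFun p : Plane →L[ℝ] Plane →L[ℝ] ℝ))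
    (Ω.nondegenerate p) _

theorem exists_equiv_formInChart (Ω : AreaForm M) {x₀ : M} {y : Plane}
    (hy : y ∈ (chartAt Plane x₀).target) :
    ∃ e : Plane ≃L[ℝ] (Plane →L[ℝ] ℝ), (e : Plane →L[ℝ] Plane →L[ℝ] ℝ) = formInChart Ω x₀ y := by
  refine exists_equiv_of_nondegenerate fun v hv ↦ ?_
  have hv' : (mfderiv (𝓡 2) (𝓡 2) (chartAt Plane x₀).symm y v : Plane) ≠ 0 := by
    intro h
    refine hv ?_
    rw [← mfderiv_chart_mfderiv_chart_symm hy v]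
    exact (congrArg (mfderiv (𝓡 2) (𝓡 2) (chartAt Plane x₀) ((chartAt Plane x₀).symm y) :
      Plane →L[ℝ] Plane) h).trans (map_zero _)
  obtain ⟨w, hw⟩ := Ω.nondegenerate _ _ hv'
  refine ⟨mfderiv (𝓡 2) (𝓡 2) (chartAt Plane x₀) ((chartAt Plane x₀).symm y) w, ?_⟩
  have := mfderiv_chart_symm_mfderiv_chart' hy w
  exact fun h ↦ hw ((congrArg (fun a : Plane ↦ (Ω.toFun ((chartAt Plane x₀).symm y) :
    Plane →L[ℝ] Plane →L[ℝ] ℝ) (mfderiv (𝓡 2) (𝓡 2) (chartAt Plane x₀).symm y v) a)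
    this).symm.trans h)

variable {c : ChainClass M →+ ℝ} (u : SmoothPotential c) (Ω : AreaForm M)

/-- The symplectic vector field with flux given by the cocycle `c`. -/
abbrev SmoothPotential.field : (p : M) → TangentSpace (𝓡 2) p := dualField Ω u.form

theorem SmoothPotential.contDiffAt_comp_symm {x₀ p : M} (hp : p ∈ chartBall x₀) :
    ContDiffAt ℝ ∞ (fun y ↦ u.toFun x₀ ((chartAt Plane x₀).symm y)) (chartAt Plane x₀ p) := by
  have hps := chartBall_subset_source x₀ hp
  refine contMDiffAt_iff_contDiffAt.1 (ContMDiffAt.comp (chartAt Plane x₀ p)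
    (g := u.toFun x₀) (f := (chartAt Plane x₀).symm) (I' := 𝓡 2) ?_ ?_)
  · rw [(chartAt Plane x₀).left_inv hps]
    exact (u.contMDiffOn x₀).contMDiffAt ((isOpen_chartBall x₀).mem_nhds hp)
  · exact (contMDiffOn_chart_symm (I := 𝓡 2) (x := x₀)).contMDiffAt
      ((chartAt Plane x₀).open_target.mem_nhds ((chartAt Plane x₀).map_source hps))

/-- The duality Ω(X, ·) = α read in a chart, with α replaced by the differential of a local
primitive; this is the hypothesis of `lieDerivative_eq_zero`. -/
theorem SmoothPotential.formInChart_field {x₀ : M} {y : Plane}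
    (hy : y ∈ (chartAt Plane x₀).target) (hyb : (chartAt Plane x₀).symm y ∈ chartBall x₀) :
    formInChart Ω x₀ y (fieldInChart (u.field Ω) x₀ y) =
      fderiv ℝ (fun y ↦ u.toFun x₀ ((chartAt Plane x₀).symm y)) y := by
  have h1 : HasFDerivAt (𝕜 := ℝ) (E := Plane) (F := ℝ)
      (fun y ↦ u.toFun x₀ ((chartAt Plane x₀).symm y))
      ((u.form ((chartAt Plane x₀).symm y) : Plane →L[ℝ] ℝ) ∘L
        (mfderiv (𝓡 2) (𝓡 2) (chartAt Plane x₀).symm y : Plane →L[ℝ] Plane)) y :=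
    hasMFDerivAt_iff_hasFDerivAt.1 ((u.hasMFDerivAt hyb).comp y
      ((mdifferentiable_chart (I := 𝓡 2) x₀).mdifferentiableAt_symm hy).hasMFDerivAt)
  rw [h1.fderiv]
  ext w
  rw [formInChart_apply]
  have h2 := mfderiv_chart_symm_mfderiv_chart' hy (u.field Ω ((chartAt Plane x₀).symm y))
  have h3 := apply_dualField Ω u.form ((chartAt Plane x₀).symm y)
  refine Eq.trans (congrArg (fun a : Plane ↦ (Ω.toFun ((chartAt Plane x₀).symm y) :
    Plane →L[ℝ] Plane →L[ℝ] ℝ) a (mfderiv (𝓡 2) (𝓡 2) (chartAt Plane x₀).symm y w)) h2) ?_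
  exact congrArg (fun A : Plane →L[ℝ] ℝ ↦
    A (mfderiv (𝓡 2) (𝓡 2) (chartAt Plane x₀).symm y w)) h3

omit [IsManifold (𝓡 2) ∞ M] in
theorem eventually_mem_target_and_symm_mem_chartBall {x₀ p : M} (hp : p ∈ chartBall x₀) :
    ∀ᶠ y in 𝓝 (chartAt Plane x₀ p), y ∈ (chartAt Plane x₀).target ∧
      (chartAt Plane x₀).symm y ∈ chartBall x₀ := by
  have hps := chartBall_subset_source x₀ hp
  refine ((chartAt Plane x₀).open_target.eventually_mem
    ((chartAt Plane x₀).map_source hps)).and ?_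
  refine ((chartAt Plane x₀).continuousAt_symm ((chartAt Plane x₀).map_source hps)).eventually ?_
  rw [(chartAt Plane x₀).left_inv hps]
  exact (isOpen_chartBall x₀).mem_nhds hp

/-- In the chart the field is the inverse of the form applied to the differential of the primitive,
and operator inversion is smooth at invertible operators. -/
theorem SmoothPotential.contDiffAt_fieldInChart {x₀ p : M} (hp : p ∈ chartBall x₀) :
    ContDiffAt ℝ ∞ (fieldInChart (u.field Ω) x₀) (chartAt Plane x₀ p) := by
  have hps := chartBall_subset_source x₀ hp
  have ht := (chartAt Plane x₀).map_source hps
  obtain ⟨e, he⟩ := exists_equiv_formInChart Ω ht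
  have h1 : ContDiffAt ℝ ∞ (fun y ↦ ContinuousLinearMap.inverse (formInChart Ω x₀ y)
      (fderiv ℝ (fun y ↦ u.toFun x₀ ((chartAt Plane x₀).symm y)) y)) (chartAt Plane x₀ p) := by
    refine ContDiffAt.clm_apply ?_ ((u.contDiffAt_comp_symm hp).fderiv_right (by simp))
    refine ContDiffAt.comp (chartAt Plane x₀ p) (g := ContinuousLinearMap.inverse) ?_
      ((contDiffOn_formInChart Ω x₀).contDiffAt ((chartAt Plane x₀).open_target.mem_nhds ht))
    rw [← he]
    exact contDiffAt_map_inverse e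
  refine h1.congr_of_eventuallyEq ?_
  filter_upwards [eventually_mem_target_and_symm_mem_chartBall hp] with y hy
  obtain ⟨e, he⟩ := exists_equiv_formInChart Ω hy.1
  rw [← u.formInChart_field Ω hy.1 hy.2, ← he, ContinuousLinearMap.inverse_equiv]
  exact (e.symm_apply_apply _).symm

theorem SmoothPotential.contMDiff_field : ContMDiff (𝓡 2) (𝓡 2).tangent ∞
    (fun x ↦ (⟨x, u.field Ω x⟩ : TangentBundle (𝓡 2) M)) := fun x ↦
  contMDiffAt_of_fieldInChart (mem_chart_source Plane x)
    (u.contDiffAt_fieldInChart Ω (mem_chartBall x))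

end DualField

/-! ### Invariance of the area form under the flow -/

section Invariance

variable {M : Type*} [TopologicalSpace M] [ChartedSpace Plane M] [IsManifold (𝓡 2) ∞ M]

theorem AreaForm.apply_congr (Ω : AreaForm M) {p q : M} (h : p = q) {a a' b b' : Plane}
    (ha : a = a') (hb : b = b') : (Ω.toFun p : Plane →L[ℝ] Plane →L[ℝ] ℝ) a b =
      (Ω.toFun q : Plane →L[ℝ] Plane →L[ℝ] ℝ) a' b' := by
  subst h ha hb; rfl

/-- A family of maps of a surface, smooth in all variables. -/
abbrev SmoothFamily (r : WithTop ℕ∞) (φ : ℝ → M → M) : Prop :=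
  ContMDiff (𝓘(ℝ, ℝ).prod (𝓡 2)) (𝓡 2) r (fun p : ℝ × M ↦ φ p.1 p.2)

omit [IsManifold (𝓡 2) ∞ M] in
theorem SmoothFamily.contMDiff_apply {φ : ℝ → M → M} {r : WithTop ℕ∞} (hφ : SmoothFamily r φ)
    (t : ℝ) : ContMDiff (𝓡 2) (𝓡 2) r (φ t) := fun x ↦
  (hφ (t, x)).comp x (contMDiffAt_const.prodMk contMDiffAt_id)

/-- A family of maps, read in charts. -/
theorem SmoothFamily.contDiffAt_inCharts {φ : ℝ → M → M} (hφ : SmoothFamily ∞ φ) (x z : M) {t : ℝ}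
    {y : Plane} (hy : y ∈ (chartAt Plane x).target)
    (hz : φ t ((chartAt Plane x).symm y) ∈ (chartAt Plane z).source) :
    ContDiffAt ℝ ∞ (fun q : ℝ × Plane ↦ chartAt Plane z (φ q.1 ((chartAt Plane x).symm q.2)))
      (t, y) := by
  have h1 : ContMDiffAt 𝓘(ℝ, ℝ × Plane) (𝓘(ℝ, ℝ).prod (𝓡 2)) ∞
      (fun q : ℝ × Plane ↦ (q.1, (chartAt Plane x).symm q.2)) (t, y) := by
    rw [modelWithCornersSelf_prod, ← chartedSpaceSelf_prod]
    refine contMDiffAt_fst.prodMk ?_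
    exact ((contMDiffOn_chart_symm (I := 𝓡 2) (x := x)).contMDiffAt
      ((chartAt Plane x).open_target.mem_nhds hy)).comp (t, y) contMDiffAt_snd
  have h2 : ContMDiffAt 𝓘(ℝ, ℝ × Plane) (𝓡 2) ∞
      (fun q : ℝ × Plane ↦ φ q.1 ((chartAt Plane x).symm q.2)) (t, y) :=
    (hφ (t, (chartAt Plane x).symm y)).comp (t, y) h1
  have h3 : ContMDiffAt (𝓡 2) (𝓡 2) ∞ (chartAt Plane z) (φ t ((chartAt Plane x).symm y)) :=
    (contMDiffOn_chart (I := 𝓡 2) (x := z)).contMDiffAt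
      ((chartAt Plane z).open_source.mem_nhds hz)
  exact contMDiffAt_iff_contDiffAt.1 (ContMDiffAt.comp (t, y) h3 h2)

variable {c : ChainClass M →+ ℝ} (u : SmoothPotential c) (Ω : AreaForm M)

/-- In the chart at p the product rule produces the three terms of the Lie derivative: one from the
moving base point and one from each pushed vector. Their sum vanishes by `lieDerivative_eq_zero`. -/
theorem hasDerivAt_pullback_zero {φ : ℝ → M → M} (hφ0 : ∀ x, φ 0 x = x)
    (hφ : SmoothFamily ∞ φ) (hint : ∀ x, IsMIntegralCurve (fun t ↦ φ t x) (u.field Ω))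
    (p : M) (v w : TangentSpace (𝓡 2) p) :
    HasDerivAt (fun s ↦ Ω.toFun (φ s p) (mfderiv (𝓡 2) (𝓡 2) (φ s) p v)
      (mfderiv (𝓡 2) (𝓡 2) (φ s) p w)) 0 0 := by
  set e := chartAt Plane p with he
  have hp : p ∈ e.source := mem_chart_source Plane p
  have hpt : e p ∈ e.target := e.map_source hp
  set G : ℝ × Plane → Plane := fun q ↦ e (φ q.1 (e.symm q.2)) with hG
  have hGd : ContDiffAt ℝ ∞ G (0, e p) := hφ.contDiffAt_inCharts p p hpt (by
    rw [hφ0, ← he, e.left_inv hp]; exact hp)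
  have hX : ∀ᶠ y in 𝓝 (e p), HasDerivAt (fun s ↦ G (s, y)) (fieldInChart (u.field Ω) p y) 0 := by
    filter_upwards [e.open_target.mem_nhds hpt] with y hy
    have h1 := hint (e.symm y) 0
    have hs : φ 0 (e.symm y) ∈ e.source := by rw [hφ0]; exact e.map_target hy
    have h2 := ((mdifferentiable_chart (I := 𝓡 2) p).mdifferentiableAt hs).hasMFDerivAt
    have h3 := (h2.comp (0 : ℝ) h1)
    have h4 : HasFDerivAt (𝕜 := ℝ) (E := ℝ) (F := Plane) (fun s ↦ G (s, y))
      ((mfderiv (𝓡 2) (𝓡 2) e (φ 0 (e.symm y)) : Plane →L[ℝ] Plane) ∘L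
        ((1 : ℝ →L[ℝ] ℝ).smulRight (u.field Ω (φ 0 (e.symm y)) : Plane))) 0 :=
      hasMFDerivAt_iff_hasFDerivAt.1 h3
    have h5 : ∀ q q' : M, q = q' → (mfderiv (𝓡 2) (𝓡 2) e q : Plane →L[ℝ] Plane)
        (u.field Ω q) = (mfderiv (𝓡 2) (𝓡 2) e q' : Plane →L[ℝ] Plane) (u.field Ω q') := by
      rintro _ _ rfl; rfl
    refine h4.hasDerivAt.congr_deriv ?_
    have h6 : ∀ (A : Plane →L[ℝ] Plane) (b : Plane),
      (A ∘L ((1 : ℝ →L[ℝ] ℝ).smulRight b)) 1 = A b := fun A b ↦ by simp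
    exact (h6 _ _).trans (h5 _ _ (hφ0 _))
  set P : ℝ → Plane →L[ℝ] Plane := fun s ↦ fderiv ℝ (fun y ↦ G (s, y)) (e p) with hP
  have hPd : HasDerivAt P (fderiv ℝ (fieldInChart (u.field Ω) p) (e p)) 0 :=
    hasDerivAt_fderiv_of_initial_velocity (hGd.of_le (by norm_cast)) hX
  set v' : Plane := mfderiv (𝓡 2) (𝓡 2) e p v with hv'
  set w' : Plane := mfderiv (𝓡 2) (𝓡 2) e p w with hw'
  have hG0 : ∀ y ∈ e.target, G (0, y) = y := fun y hy ↦ by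
    simp only [hG, hφ0]; exact e.right_inv hy
  have hP0 : P 0 = .id ℝ Plane := by
    have : (fun y ↦ G (0, y)) =ᶠ[𝓝 (e p)] id := by
      filter_upwards [e.open_target.mem_nhds hpt] with y hy using hG0 y hy
    simp only [hP]
    rw [this.fderiv_eq, fderiv_id]
  have hP_eq : ∀ s, φ s p ∈ e.source → ∀ a : TangentSpace (𝓡 2) p,
      P s (mfderiv (𝓡 2) (𝓡 2) e p a) =
        (mfderiv (𝓡 2) (𝓡 2) e (φ s p) (mfderiv (𝓡 2) (𝓡 2) (φ s) p a) : Plane) := by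
    intro s hs a
    have h1 : MDifferentiableAt (𝓡 2) (𝓡 2) e.symm (e p) :=
      (mdifferentiable_chart (I := 𝓡 2) p).mdifferentiableAt_symm hpt
    have h2 : MDifferentiableAt (𝓡 2) (𝓡 2) (φ s) (e.symm (e p)) :=
      ((hφ.contMDiff_apply s) _).mdifferentiableAt (by simp)
    have h3 : MDifferentiableAt (𝓡 2) (𝓡 2) e (φ s (e.symm (e p))) :=
      (mdifferentiable_chart (I := 𝓡 2) p).mdifferentiableAt (by rwa [e.left_inv hp])
    have h4 : HasFDerivAt (𝕜 := ℝ) (E := Plane) (F := Plane) (fun y ↦ G (s, y))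
        ((mfderiv (𝓡 2) (𝓡 2) e (φ s (e.symm (e p))) : Plane →L[ℝ] Plane) ∘L
          (mfderiv (𝓡 2) (𝓡 2) (φ s) (e.symm (e p)) : Plane →L[ℝ] Plane) ∘L
          (mfderiv (𝓡 2) (𝓡 2) e.symm (e p) : Plane →L[ℝ] Plane)) (e p) :=
      hasMFDerivAt_iff_hasFDerivAt.1 (h3.hasMFDerivAt.comp (e p)
        (h2.hasMFDerivAt.comp (e p) h1.hasMFDerivAt))
    have h5 : ∀ q, q = p → (mfderiv (𝓡 2) (𝓡 2) e (φ s q) : Plane →L[ℝ] Plane)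
        ((mfderiv (𝓡 2) (𝓡 2) (φ s) q : Plane →L[ℝ] Plane) a) =
        (mfderiv (𝓡 2) (𝓡 2) e (φ s p) : Plane →L[ℝ] Plane)
        ((mfderiv (𝓡 2) (𝓡 2) (φ s) p : Plane →L[ℝ] Plane) a) := by rintro _ rfl; rfl
    simp only [hP]
    rw [h4.fderiv]
    refine Eq.trans ?_ (h5 _ (e.left_inv hp))
    exact congrArg (fun b : Plane ↦ (mfderiv (𝓡 2) (𝓡 2) e (φ s (e.symm (e p))) :
      Plane →L[ℝ] Plane) ((mfderiv (𝓡 2) (𝓡 2) (φ s) (e.symm (e p)) : Plane →L[ℝ] Plane) b))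
      (mfderiv_chart_symm_mfderiv_chart hp a)
  have hGp : ∀ s, G (s, e p) = e (φ s p) := fun s ↦ by simp only [hG, e.left_inv hp]
  have hk : (fun s ↦ Ω.toFun (φ s p) (mfderiv (𝓡 2) (𝓡 2) (φ s) p v)
      (mfderiv (𝓡 2) (𝓡 2) (φ s) p w)) =ᶠ[𝓝 0]
      fun s ↦ formInChart Ω p (G (s, e p)) (P s v') (P s w') := by
    have hcont : ContinuousAt (fun s ↦ φ s p) 0 := (hint p).continuous.continuousAt
    filter_upwards [hcont.eventually (e.open_source.mem_nhds (by simp only [hφ0]; exact hp))] with s hs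
    rw [formInChart_apply, hGp]
    refine Ω.apply_congr (e.left_inv hs).symm ?_ ?_
    · rw [hv', hP_eq s hs]
      exact (mfderiv_chart_symm_mfderiv_chart hs _).symm
    · rw [hw', hP_eq s hs]
      exact (mfderiv_chart_symm_mfderiv_chart hs _).symm
  refine HasDerivAt.congr_of_eventuallyEq ?_ hk
  have hpb := mem_chartBall p
  have hB : DifferentiableAt ℝ (formInChart Ω p) (e p) :=
    ((contDiffOn_formInChart Ω p).contDiffAt (e.open_target.mem_nhds hpt)).differentiableAt
      (by simp)
  have hLie := lieDerivative_eq_zero hB (.of_forall fun y a ↦ Ω.alternating _ _)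
    ((u.contDiffAt_fieldInChart Ω hpb).differentiableAt (by simp))
    ((u.contDiffAt_comp_symm hpb).of_le (by norm_cast))
    ((eventually_mem_target_and_symm_mem_chartBall hpb).mono fun y hy ↦
      u.formInChart_field Ω hy.1 hy.2) v' w'
  have hB' : HasDerivAt (fun s ↦ formInChart Ω p (G (s, e p)))
      (fderiv ℝ (formInChart Ω p) (e p) (fieldInChart (u.field Ω) p (e p))) 0 := by
    have h1 := hX.self_of_nhds
    have h2 : HasFDerivAt (formInChart Ω p) (fderiv ℝ (formInChart Ω p) (e p)) (G (0, e p)) := by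
      rw [hG0 _ hpt]; exact hB.hasFDerivAt
    have h3 := HasFDerivAt.comp_hasDerivAt (f := fun s ↦ G (s, e p)) (x := (0 : ℝ))
      (l := formInChart Ω p) (l' := fderiv ℝ (formInChart Ω p) (e p)) (hl := h2) h1
    exact h3
  have hfin := (hB'.clm_apply (hPd.clm_apply (hasDerivAt_const (0 : ℝ) v'))).clm_apply
    (hPd.clm_apply (hasDerivAt_const (0 : ℝ) w'))
  refine hfin.congr_deriv ?_
  simp only [hP0, hG0 _ hpt, map_zero, add_zero, add_apply, ContinuousLinearMap.id_apply]
  exact hLie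

/-- The flow of the vector field dual to a closed 1-form preserves the area form. -/
theorem pullback_flow_eq {φ : ℝ → M → M} (hφ0 : ∀ x, φ 0 x = x)
    (hadd : ∀ s t x, φ (s + t) x = φ s (φ t x))
    (hφ : SmoothFamily ∞ φ) (hint : ∀ x, IsMIntegralCurve (fun t ↦ φ t x) (u.field Ω))
    (t : ℝ) (p : M) (v w : TangentSpace (𝓡 2) p) :
    Ω.toFun (φ t p) (mfderiv (𝓡 2) (𝓡 2) (φ t) p v) (mfderiv (𝓡 2) (𝓡 2) (φ t) p w) =
      Ω.toFun p v w := by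
  set k : ℝ → ℝ := fun t ↦ Ω.toFun (φ t p) (mfderiv (𝓡 2) (𝓡 2) (φ t) p v)
    (mfderiv (𝓡 2) (𝓡 2) (φ t) p w) with hk
  have hder : ∀ t, HasDerivAt k 0 t := by
    intro t
    have h1 := hasDerivAt_pullback_zero u Ω hφ0 hφ hint (φ t p)
      (mfderiv (𝓡 2) (𝓡 2) (φ t) p v) (mfderiv (𝓡 2) (𝓡 2) (φ t) p w)
    -- The group law turns the derivative at time t into a derivative at time 0, at the point φ_t(p)
    -- and for the pushed vectors.
    have h2 : k = (fun s ↦ Ω.toFun (φ s (φ t p))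
        (mfderiv (𝓡 2) (𝓡 2) (φ s) (φ t p) (mfderiv (𝓡 2) (𝓡 2) (φ t) p v))
        (mfderiv (𝓡 2) (𝓡 2) (φ s) (φ t p) (mfderiv (𝓡 2) (𝓡 2) (φ t) p w))) ∘
        fun τ ↦ τ - t := by
      funext τ
      have hτ : φ τ = φ (τ - t) ∘ φ t := by
        funext x
        rw [Function.comp, ← hadd, sub_add_cancel]
      have hcomp : mfderiv (𝓡 2) (𝓡 2) (φ (τ - t) ∘ φ t) p =
          (mfderiv (𝓡 2) (𝓡 2) (φ (τ - t)) (φ t p)).comp (mfderiv (𝓡 2) (𝓡 2) (φ t) p) :=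
        mfderiv_comp p (((hφ.contMDiff_apply _) _).mdifferentiableAt (by simp))
          (((hφ.contMDiff_apply _) _).mdifferentiableAt (by simp))
      simp only [hk]
      rw [hτ, hcomp]
      rfl
    rw [h2]
    have h3 : HasDerivAt (fun τ : ℝ ↦ τ - t) 1 t := (hasDerivAt_id t).sub_const t
    have h4 := HasDerivAt.comp_of_eq t h1 h3 (sub_self t).symm
    simpa using h4
  have hconst := is_const_of_deriv_eq_zero (fun t ↦ (hder t).differentiableAt)
    (fun t ↦ (hder t).deriv) t 0
  have h0 : φ 0 = id := funext hφ0
  refine hconst.trans ?_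
  simp only [hk]
  rw [h0, mfderiv_id]
  rfl

end Invariance

/-! ### Integration over the standard triangle -/

section TriangleIntegral

theorem isClosed_triangle : IsClosed triangle :=
  (isClosed_le continuous_const continuous_fst).inter
    ((isClosed_le continuous_const continuous_snd).inter
      (isClosed_le (continuous_fst.add continuous_snd) continuous_const))

theorem convex_triangle : Convex ℝ triangle := by
  rintro ⟨x, y⟩ ⟨hx, hy, hxy⟩ ⟨x', y'⟩ ⟨hx', hy', hxy'⟩ a b ha hb hab
  simp only at *
  refine ⟨?_, ?_, ?_⟩
  · simp only [Prod.smul_mk, Prod.mk_add_mk, smul_eq_mul]; positivity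
  · simp only [Prod.smul_mk, Prod.mk_add_mk, smul_eq_mul]; positivity
  · simp only [Prod.smul_mk, Prod.mk_add_mk, smul_eq_mul]
    nlinarith

theorem isCompact_triangle : IsCompact triangle := by
  refine (isCompact_Icc.prod isCompact_Icc : IsCompact (Set.Icc (0 : ℝ) 1 ×ˢ
    Set.Icc (0 : ℝ) 1)).of_isClosed_subset isClosed_triangle ?_
  rintro ⟨x, y⟩ ⟨hx, hy, hxy⟩
  simp only at hx hy hxy
  exact ⟨⟨hx, by simp only; linarith⟩, hy, by simp only; linarith⟩

theorem pos_of_mem_interior_triangle {p : ℝ × ℝ} (hp : p ∈ interior triangle) :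
    0 < p.1 ∧ 0 < p.2 ∧ p.1 + p.2 < 1 := by
  rw [mem_interior_iff_mem_nhds] at hp
  obtain ⟨ε, hε, hball⟩ := Metric.mem_nhds_iff.1 hp
  have hmem : ∀ a b : ℝ, |a| < ε → |b| < ε → (p.1 + a, p.2 + b) ∈ triangle := by
    intro a b ha hb
    refine hball ?_
    rw [Metric.mem_ball, Prod.dist_eq, Real.dist_eq, Real.dist_eq]
    simp [ha, hb]
  have h2 : |ε / 2| < ε := by rw [abs_of_pos (half_pos hε)]; exact half_lt_self hε
  have h2' : |-(ε / 2)| < ε := by rwa [abs_neg]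
  have h0 : |(0 : ℝ)| < ε := by simpa
  have a1 := (hmem _ _ h2' h0).1
  have a2 := (hmem _ _ h0 h2').2.1
  have a3 := (hmem _ _ h2 h0).2.2
  simp only at a1 a2 a3
  exact ⟨by linarith, by linarith, by linarith⟩

/-- The frontier of a convex set is null. Integrands need be compared only in the interior, where
derivatives within the triangle are ordinary ones and curve parameters lie in (0, 1). -/
theorem setIntegral_triangle_congr {F G : ℝ × ℝ → ℝ}
    (h : ∀ p ∈ interior triangle, F p = G p) : ∫ p in triangle, F p = ∫ p in triangle, G p := by
  have hae : interior triangle =ᵐ[MeasureTheory.volume] triangle :=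
    interior_ae_eq_of_null_frontier (convex_triangle.addHaar_frontier _)
  rw [← MeasureTheory.setIntegral_congr_set hae, ← MeasureTheory.setIntegral_congr_set hae]
  exact MeasureTheory.setIntegral_congr_fun isOpen_interior.measurableSet h

/-- Fubini's theorem on the triangle, for the two coordinates of the square that is made of two
copies of the triangle. -/
theorem setIntegral_triangle_add {P : ℝ → ℝ} (hP : Continuous P) :
    ∫ p in triangle, (P p.2 + P (p.1 + p.2)) = ∫ s in (0 : ℝ)..1, P s := by
  have hint : MeasureTheory.IntegrableOn (fun p : ℝ × ℝ ↦ P p.2 + P (p.1 + p.2)) triangle :=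
    ContinuousOn.integrableOn_compact isCompact_triangle (by fun_prop)
  rw [← MeasureTheory.integral_indicator isClosed_triangle.measurableSet,
    MeasureTheory.Measure.volume_eq_prod, MeasureTheory.integral_prod_symm _ (by
      rw [← MeasureTheory.Measure.volume_eq_prod]
      exact (MeasureTheory.integrable_indicator_iff isClosed_triangle.measurableSet).2 hint)]
  have hinner : ∀ y : ℝ, (∫ x, triangle.indicator (fun p : ℝ × ℝ ↦ P p.2 + P (p.1 + p.2)) (x, y)) =
      (Set.Icc (0 : ℝ) 1).indicator
        (fun y ↦ (∫ s in y..1, P s) + (1 - y) * P y) y := by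
    intro y
    by_cases hy : y ∈ Set.Icc (0 : ℝ) 1
    · have hset : (fun x ↦ triangle.indicator (fun p : ℝ × ℝ ↦ P p.2 + P (p.1 + p.2)) (x, y)) =
          (Set.Icc (0 : ℝ) (1 - y)).indicator (fun x ↦ P y + P (x + y)) := by
        funext x
        by_cases hx : x ∈ Set.Icc (0 : ℝ) (1 - y)
        · have hm : (x, y) ∈ triangle := ⟨hx.1, hy.1, by have := hx.2; simp only; linarith⟩
          rw [Set.indicator_of_mem hx, Set.indicator_of_mem hm]
        · have hm : (x, y) ∉ triangle := fun h ↦ hx ⟨h.1, by have := h.2.2; simp only at this; linarith⟩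
          rw [Set.indicator_of_notMem hx, Set.indicator_of_notMem hm]
      have hy1 : (0 : ℝ) ≤ 1 - y := by linarith [hy.2]
      rw [hset, MeasureTheory.integral_indicator measurableSet_Icc,
        MeasureTheory.integral_Icc_eq_integral_Ioc, ← intervalIntegral.integral_of_le hy1,
        intervalIntegral.integral_add (f := fun _ ↦ P y) (g := fun x ↦ P (x + y))
          (Continuous.intervalIntegrable (by fun_prop) _ _)
          (Continuous.intervalIntegrable (by fun_prop) _ _),
        intervalIntegral.integral_const, intervalIntegral.integral_comp_add_right,
        Set.indicator_of_mem hy]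
      simp only [sub_zero, zero_add, sub_add_cancel, smul_eq_mul]
      ring
    · have hzero : (fun x ↦ triangle.indicator (fun p : ℝ × ℝ ↦ P p.2 + P (p.1 + p.2)) (x, y)) =
          fun _ ↦ 0 := by
        funext x
        refine Set.indicator_of_notMem (fun h ↦ hy ⟨h.2.1, ?_⟩) _
        have h1 := h.1
        have h2 := h.2.2
        simp only at h1 h2
        linarith
      rw [hzero, Set.indicator_of_notMem hy, MeasureTheory.integral_zero]
  simp_rw [hinner]
  rw [MeasureTheory.integral_indicator measurableSet_Icc,
    MeasureTheory.integral_Icc_eq_integral_Ioc, ← intervalIntegral.integral_of_le zero_le_one]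
  have hQ : ∀ y : ℝ, HasDerivAt (fun y ↦ ∫ s in y..1, P s) (-P y) y := fun y ↦
    intervalIntegral.integral_hasDerivAt_left (hP.intervalIntegrable _ _)
      (hP.stronglyMeasurableAtFilter _ _) hP.continuousAt
  have hQc : Continuous fun y ↦ ∫ s in y..1, P s :=
    continuous_iff_continuousAt.2 fun y ↦ (hQ y).continuousAt
  -- The integrand left after the inner integration has this explicit primitive; it is 0 at y = 1
  -- and minus the full integral at y = 0.
  have hQd : ∀ y : ℝ, HasDerivAt (fun y ↦ (y - 1) * ∫ s in y..1, P s)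
      ((∫ s in y..1, P s) + (1 - y) * P y) y := fun y ↦ by
    refine (((hasDerivAt_id y).sub_const 1).mul (hQ y)).congr_deriv ?_
    simp only [id]
    ring
  rw [intervalIntegral.integral_eq_sub_of_hasDerivAt (fun y _ ↦ hQd y)
    (Continuous.intervalIntegrable (by fun_prop) _ _)]
  simp

end TriangleIntegral

/-! ### The area swept by a closed curve under the flow -/

section SweptArea

variable {M : Type*} [TopologicalSpace M] [ChartedSpace Plane M] [IsManifold (𝓡 2) ∞ M]

/-- The velocity of a curve. -/
def velocity (γ : ℝ → M) (s : ℝ) : TangentSpace (𝓡 2) (γ s) :=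
  mfderiv 𝓘(ℝ, ℝ) (𝓡 2) γ s (1 : ℝ)

-- Chain rule for a swept simplex: α is the time and β the curve parameter, as linear functions on
-- the triangle.
omit [IsManifold (𝓡 2) ∞ M] in
theorem mfderiv_sweep {φ : ℝ → M → M} {X : ∀ x : M, TangentSpace (𝓡 2) x}
    (hφ : SmoothFamily ∞ φ) (hint : ∀ x, IsMIntegralCurve (fun t ↦ φ t x) X)
    {γ : ℝ → M} (α β : ℝ × ℝ →L[ℝ] ℝ) {p : ℝ × ℝ}
    (hγ : MDifferentiableAt 𝓘(ℝ, ℝ) (𝓡 2) γ (β p)) (v : ℝ × ℝ) :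
    (mfderiv 𝓘(ℝ, ℝ × ℝ) (𝓡 2) (fun p ↦ φ (α p) (γ (β p))) p : ℝ × ℝ →L[ℝ] Plane) v =
      α v • (X (φ (α p) (γ (β p))) : Plane) + β v •
        (mfderiv (𝓡 2) (𝓡 2) (φ (α p)) (γ (β p)) : Plane →L[ℝ] Plane) (velocity γ (β p)) := by
  have hα : HasMFDerivAt 𝓘(ℝ, ℝ × ℝ) 𝓘(ℝ, ℝ) α p α :=
    hasMFDerivAt_iff_hasFDerivAt.2 α.hasFDerivAt
  have hβ : HasMFDerivAt 𝓘(ℝ, ℝ × ℝ) 𝓘(ℝ, ℝ) β p β :=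
    hasMFDerivAt_iff_hasFDerivAt.2 β.hasFDerivAt
  have h1 := hα.prodMk (hγ.hasMFDerivAt.comp p hβ)
  have h2 : MDifferentiableAt (𝓘(ℝ, ℝ).prod (𝓡 2)) (𝓡 2) (fun q : ℝ × M ↦ φ q.1 q.2)
      (α p, γ (β p)) := (hφ _).mdifferentiableAt (by simp)
  have h3 := (h2.hasMFDerivAt.comp p h1).mfderiv
  have h4 : mfderiv 𝓘(ℝ, ℝ) (𝓡 2) (fun t ↦ φ t (γ (β p))) (α p) = _ := (hint (γ (β p)) (α p)).mfderiv
  have h5 : ∀ w : ℝ × Plane, (mfderiv (𝓘(ℝ, ℝ).prod (𝓡 2)) (𝓡 2) (fun q : ℝ × M ↦ φ q.1 q.2)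
      (α p, γ (β p)) : ℝ × Plane →L[ℝ] Plane) w = w.1 • (X (φ (α p) (γ (β p))) : Plane) +
      (mfderiv (𝓡 2) (𝓡 2) (φ (α p)) (γ (β p)) : Plane →L[ℝ] Plane) w.2 := by
    intro w
    refine (mfderiv_prod_eq_add_apply (v := w) h2).trans ?_
    dsimp only
    rw [h4]
    rfl
  have h6 : (mfderiv 𝓘(ℝ, ℝ × ℝ) (𝓡 2) (fun p ↦ φ (α p) (γ (β p))) p : ℝ × ℝ →L[ℝ] Plane) v =
    (mfderiv (𝓘(ℝ, ℝ).prod (𝓡 2)) (𝓡 2) (fun q : ℝ × M ↦ φ q.1 q.2)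
      (α p, γ (β p)) : ℝ × Plane →L[ℝ] Plane) (α v, (mfderiv 𝓘(ℝ, ℝ) (𝓡 2) γ (β p) : ℝ →L[ℝ] Plane) (β v)) :=
    congrArg (fun L : ℝ × ℝ →L[ℝ] Plane ↦ L v) h3
  rw [h6, h5]
  congr 1
  have h7 : ∀ (A : Plane →L[ℝ] Plane) (L : ℝ →L[ℝ] Plane) (s : ℝ), A (L s) = s • A (L 1) := by
    intro A L s
    rw [← map_smul, ← map_smul, smul_eq_mul, mul_one]
  exact h7 _ _ _

omit [IsManifold (𝓡 2) ∞ M] in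
/-- A flow preserves its generating vector field. -/
theorem mfderiv_flow_apply_field {φ : ℝ → M → M} {X : ∀ x : M, TangentSpace (𝓡 2) x}
    (hφ0 : ∀ x, φ 0 x = x) (hadd : ∀ s t x, φ (s + t) x = φ s (φ t x))
    (hφ : SmoothFamily ∞ φ) (hint : ∀ x, IsMIntegralCurve (fun t ↦ φ t x) X) (t : ℝ) (p : M) :
    (mfderiv (𝓡 2) (𝓡 2) (φ t) p : Plane →L[ℝ] Plane) (X p) = X (φ t p) := by
  have h1 : MDifferentiableAt (𝓡 2) (𝓡 2) (φ t) (φ 0 p) :=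
    ((hφ.contMDiff_apply t) _).mdifferentiableAt (by simp)
  have h2 := (h1.hasMFDerivAt.comp (0 : ℝ) (hint p 0)).mfderiv
  have h3 := (hint (φ t p) 0).mfderiv
  have h4 : (φ t ∘ fun s ↦ φ s p) = fun s ↦ φ s (φ t p) := by
    funext s
    rw [Function.comp, ← hadd, ← hadd, add_comm]
  rw [h4] at h2
  have h5 := congrArg (fun L : ℝ →L[ℝ] Plane ↦ L 1) (h2.symm.trans h3)
  have h6 : ∀ q, q = p → (mfderiv (𝓡 2) (𝓡 2) (φ t) q : Plane →L[ℝ] Plane) (X q) =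
      (mfderiv (𝓡 2) (𝓡 2) (φ t) p : Plane →L[ℝ] Plane) (X p) := by rintro _ rfl; rfl
  have h7 : ∀ q q', q = q' → (X q : Plane) = X q' := by rintro _ _ rfl; rfl
  have h8 : ∀ (A : Plane →L[ℝ] Plane) (b : Plane),
    (A ∘L ((1 : ℝ →L[ℝ] ℝ).smulRight b)) 1 = A b := fun A b ↦ by simp
  have h9 : ∀ b : Plane, ((1 : ℝ →L[ℝ] ℝ).smulRight b) 1 = b := fun b ↦ by simp
  exact (h6 _ (hφ0 p)).symm.trans ((h8 _ _).symm.trans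
    (h5.trans ((h9 _).trans (h7 _ _ (hφ0 (φ t p))))))

variable {c : ChainClass M →+ ℝ} (u : SmoothPotential c) (Ω : AreaForm M)

/-- The flow preserves both Ω and X, so the area density of the swept surface does not depend on
time. -/
theorem area_field_pushforward {φ : ℝ → M → M} (hφ0 : ∀ x, φ 0 x = x)
    (hadd : ∀ s t x, φ (s + t) x = φ s (φ t x))
    (hφ : SmoothFamily ∞ φ) (hint : ∀ x, IsMIntegralCurve (fun t ↦ φ t x) (u.field Ω))
    (t : ℝ) (p : M) (v : Plane) :
    (Ω.toFun (φ t p) : Plane →L[ℝ] Plane →L[ℝ] ℝ) (u.field Ω (φ t p))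
      ((mfderiv (𝓡 2) (𝓡 2) (φ t) p : Plane →L[ℝ] Plane) v) =
      (u.form p : Plane →L[ℝ] ℝ) v := by
  have h := pullback_flow_eq u Ω hφ0 hadd hφ hint t p (u.field Ω p) v
  have h1 := congrArg (fun L : Plane →L[ℝ] ℝ ↦ L v) (apply_dualField Ω u.form p)
  refine Eq.trans (Eq.trans ?_ h) h1
  exact Ω.apply_congr rfl (mfderiv_flow_apply_field hφ0 hadd hφ hint t p).symm rfl

theorem alternating_apply_combination {B : Plane →L[ℝ] Plane →L[ℝ] ℝ} (hB : ∀ v, B v v = 0)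
    (x y : Plane) (a b a' b' : ℝ) :
    B (a • x + b • y) (a' • x + b' • y) = (a * b' - a' * b) * B x y := by
  rw [alternating_apply_eq hB, alternating_apply_eq hB x y]
  simp only [PiLp.add_apply, PiLp.smul_apply, smul_eq_mul]
  ring

/-- The factor in front is the determinant of (α, β); what remains is the 1-form evaluated on the
velocity of γ, which is the derivative of the primitive. -/
theorem simplexIntegral_sweep {φ : ℝ → M → M} (hφ0 : ∀ x, φ 0 x = x)
    (hadd : ∀ s t x, φ (s + t) x = φ s (φ t x))
    (hφ : SmoothFamily ∞ φ) (hint : ∀ x, IsMIntegralCurve (fun t ↦ φ t x) (u.field Ω))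
    {γ : ℝ → M} (hγ : ContMDiffOn 𝓘(ℝ, ℝ) (𝓡 2) 1 γ (Set.Icc 0 1)) (α β : ℝ × ℝ →L[ℝ] ℝ)
    (hβ : ∀ p ∈ interior triangle, β p ∈ Set.Ioo (0 : ℝ) 1) :
    simplexIntegral Ω (fun p ↦ φ (α p) (γ (β p))) =
      ∫ p in triangle, (α (1, 0) * β (0, 1) - α (0, 1) * β (1, 0)) * deriv (u.primitive γ) (β p) := by
  refine setIntegral_triangle_congr fun p hp ↦ ?_
  have hs := hβ p hp
  have hγs : MDifferentiableAt 𝓘(ℝ, ℝ) (𝓡 2) γ (β p) :=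
    (hγ.contMDiffAt (Icc_mem_nhds hs.1 hs.2)).mdifferentiableAt one_ne_zero
  rw [(u.hasDerivAt_primitive hγ hs).deriv,
    mfderivWithin_of_mem_nhds (mem_interior_iff_mem_nhds.1 hp)]
  have h := mfderiv_sweep hφ hint α β hγs
  refine (Ω.apply_congr rfl (h (1, 0)) (h (0, 1))).trans ?_
  refine (alternating_apply_combination (Ω.alternating _) _ _ _ _ _ _).trans ?_
  exact congrArg _ (area_field_pushforward u Ω hφ0 hadd hφ hint (α p) (γ (β p)) _)

theorem chainIntegral_add (D D' : Chain₂ M) :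
    chainIntegral Ω (D + D') = chainIntegral Ω D + chainIntegral Ω D' :=
  Finsupp.sum_add_index' (fun _ ↦ by simp) fun _ _ _ ↦ by push_cast; ring

theorem chainIntegral_single (σ : ℝ × ℝ → M) (n : ℤ) :
    chainIntegral Ω (Finsupp.single σ n) = n * simplexIntegral Ω σ :=
  Finsupp.sum_single_index (by simp)

theorem chainIntegral_squareChain (K : ℝ × ℝ → M) : chainIntegral Ω (squareChain K) =
    simplexIntegral Ω (fun p ↦ K (p.2, p.1 + p.2)) -
      simplexIntegral Ω (fun p ↦ K (p.1 + p.2, p.2)) := by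
  rw [squareChain, sub_eq_add_neg, ← Finsupp.single_neg, chainIntegral_add, chainIntegral_single,
    chainIntegral_single]
  push_cast
  ring

/-- The area swept by the closed curve `γ` under the flow. -/
theorem chainIntegral_sweep {φ : ℝ → M → M} (hφ0 : ∀ x, φ 0 x = x)
    (hadd : ∀ s t x, φ (s + t) x = φ s (φ t x))
    (hφ : SmoothFamily ∞ φ) (hint : ∀ x, IsMIntegralCurve (fun t ↦ φ t x) (u.field Ω))
    {γ : ℝ → M} (hγ : ContMDiffOn 𝓘(ℝ, ℝ) (𝓡 2) 1 γ (Set.Icc 0 1)) (hγ01 : γ 0 = γ 1) (T : ℝ) :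
    chainIntegral Ω (squareChain fun q ↦ φ (T * q.2) (γ q.1)) =
      T * c (pathClass fun t : unitInterval ↦ γ t) := by
  set w := u.primitive γ with hw
  have hwc : ContDiffOn ℝ 1 w (Set.Icc 0 1) := u.contDiffOn_primitive hγ
  have hdc : ContinuousOn (derivWithin w (Set.Icc 0 1)) (Set.Icc 0 1) :=
    hwc.continuousOn_derivWithin (uniqueDiffOn_Icc zero_lt_one) le_rfl
  -- The primitive is C^1 on [0, 1] only; `P` extends its derivative continuously to the line, as
  -- `setIntegral_triangle_add` requires.
  set P : ℝ → ℝ := Set.IccExtend zero_le_one ((Set.Icc (0 : ℝ) 1).domRestrict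
    (derivWithin w (Set.Icc 0 1))) with hP
  have hPc : Continuous P := (continuousOn_iff_continuous_domRestrict.1 hdc).Icc_extend'
  have hPd : ∀ s ∈ Set.Ioo (0 : ℝ) 1, P s = deriv w s := fun s hs ↦ by
    rw [hP, Set.IccExtend_of_mem _ _ (Set.Ioo_subset_Icc_self hs)]
    exact derivWithin_of_mem_nhds (Icc_mem_nhds hs.1 hs.2)
  have hPint : ∫ s in (0 : ℝ)..1, P s = w 1 - w 0 :=
    intervalIntegral.integral_eq_sub_of_hasDerivAt_of_le zero_le_one hwc.continuousOn
      (fun s hs ↦ by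
        rw [hPd s hs]
        exact (u.hasDerivAt_primitive hγ hs).differentiableAt.hasDerivAt)
      (hPc.intervalIntegrable _ _)
  let x : ℝ × ℝ →L[ℝ] ℝ := .fst ℝ ℝ ℝ
  let y : ℝ × ℝ →L[ℝ] ℝ := .snd ℝ ℝ ℝ
  -- The two halves of the square have determinants T and -T and enter the chain with opposite
  -- signs, so their contributions add.
  have h1 := simplexIntegral_sweep u Ω hφ0 hadd hφ hint hγ (T • (x + y)) y fun p hp ↦ by
    obtain ⟨a1, a2, a3⟩ := pos_of_mem_interior_triangle hp
    exact ⟨a2, by simp only [y, ContinuousLinearMap.coe_snd']; linarith⟩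
  have h2 := simplexIntegral_sweep u Ω hφ0 hadd hφ hint hγ (T • y) (x + y) fun p hp ↦ by
    obtain ⟨a1, a2, a3⟩ := pos_of_mem_interior_triangle hp
    exact ⟨by simp only [x, y, add_apply, ContinuousLinearMap.coe_fst',
      ContinuousLinearMap.coe_snd']; linarith, a3⟩
  simp only [x, y, add_apply, smul_apply,
    ContinuousLinearMap.coe_fst', ContinuousLinearMap.coe_snd', smul_eq_mul] at h1 h2
  rw [chainIntegral_squareChain, h1, h2, ← u.primitive_one_sub_zero hγ01, ← hPint,
    ← setIntegral_triangle_add hPc, ← MeasureTheory.integral_const_mul]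
  have e1 : ∫ p in triangle, (T * (1 + 0) * 1 - T * (0 + 1) * 0) * deriv w p.2 =
      ∫ p in triangle, T * P p.2 := setIntegral_triangle_congr fun p hp ↦ by
    obtain ⟨a1, a2, a3⟩ := pos_of_mem_interior_triangle hp
    rw [hPd p.2 ⟨a2, by linarith⟩]; ring
  have e2 : ∫ p in triangle, (T * 0 * (0 + 1) - T * 1 * (1 + 0)) * deriv w (p.1 + p.2) =
      ∫ p in triangle, -(T * P (p.1 + p.2)) := setIntegral_triangle_congr fun p hp ↦ by
    obtain ⟨a1, a2, a3⟩ := pos_of_mem_interior_triangle hp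
    rw [hPd (p.1 + p.2) ⟨by linarith, a3⟩]; ring
  rw [e1, e2, ← MeasureTheory.integral_sub]
  · congr 1
    funext p
    ring
  · exact ContinuousOn.integrableOn_compact isCompact_triangle (by fun_prop)
  · exact ContinuousOn.integrableOn_compact isCompact_triangle (by fun_prop)

omit [IsManifold (𝓡 2) ∞ M] in
theorem SmoothFamily.contMDiffOn_sweep {φ : ℝ → M → M} (hφ : SmoothFamily ∞ φ)
    {γ : ℝ → M} (hγ : ContMDiffOn 𝓘(ℝ, ℝ) (𝓡 2) 1 γ (Set.Icc 0 1)) (T : ℝ) :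
    ContMDiffOn 𝓘(ℝ, ℝ × ℝ) (𝓡 2) 1 (fun q : ℝ × ℝ ↦ φ (T * q.2) (γ q.1))
      (Set.Icc 0 1 ×ˢ Set.Icc 0 1) := by
  have h1 : ContMDiffOn 𝓘(ℝ, ℝ × ℝ) (𝓡 2) 1 (fun q : ℝ × ℝ ↦ γ q.1)
      (Set.Icc 0 1 ×ˢ Set.Icc 0 1) :=
    hγ.comp (f := fun q : ℝ × ℝ ↦ q.1) (ContDiff.contMDiff (by fun_prop)).contMDiffOn
      fun q hq ↦ hq.1
  have h2 : ContMDiffOn 𝓘(ℝ, ℝ × ℝ) 𝓘(ℝ, ℝ) 1 (fun q : ℝ × ℝ ↦ T * q.2)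
      (Set.Icc 0 1 ×ˢ Set.Icc 0 1) := (ContDiff.contMDiff (by fun_prop)).contMDiffOn
  exact (hφ.of_le (by simp)).comp_contMDiffOn (h2.prodMk h1)

end SweptArea

/-! ### Joint continuity of partial derivatives -/

section PartialDerivatives

variable {E F : Type*} [NormedAddCommGroup E] [NormedSpace ℝ E] [NormedAddCommGroup F]
  [NormedSpace ℝ F]

/-- The iterated partial derivatives of a function of class `C^j` are jointly continuous. -/
theorem continuousAt_iteratedFDeriv_partial {j : ℕ} {G : ℝ × E → F} {q : ℝ × E}
    (hG : ContDiffAt ℝ j G q) :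
    ContinuousAt (fun q : ℝ × E ↦ iteratedFDeriv ℝ j (fun z ↦ G (q.1, z)) q.2) q := by
  obtain ⟨s, hs, hGs⟩ := hG.contDiffOn le_rfl (by simp)
  obtain ⟨U, hUs, hU, hqU⟩ := mem_nhds_iff.1 hs
  have hGU := hGs.mono hUs
  have hev : (fun q : ℝ × E ↦ iteratedFDeriv ℝ j (fun z ↦ G (q.1, z)) q.2) =ᶠ[𝓝 q] fun q ↦
      ContinuousMultilinearMap.compContinuousLinearMapL
        (fun _ : Fin j ↦ ContinuousLinearMap.inr ℝ ℝ E) (iteratedFDeriv ℝ j G q) := by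
    filter_upwards [hU.mem_nhds hqU] with p hp
    -- Translation by `A` makes the slice z ↦ (p.1, z) a linear inclusion, so the partial
    -- derivatives are the full ones composed with that inclusion.
    set A : ℝ × E := (p.1, 0) with hA
    have hW : IsOpen ((fun z ↦ z + A) ⁻¹' U) := hU.preimage (by fun_prop)
    have hmem : ContinuousLinearMap.inr ℝ ℝ E p.2 ∈ (fun z ↦ z + A) ⁻¹' U := by
      simpa [hA] using hp
    have hc : ContDiffOn ℝ j (fun z ↦ G (z + A)) ((fun z ↦ z + A) ⁻¹' U) :=
      hGU.comp (by fun_prop) fun z hz ↦ hz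
    have hW' := hW.preimage (ContinuousLinearMap.inr ℝ ℝ E).continuous
    have h := (ContinuousLinearMap.inr ℝ ℝ E).iteratedFDerivWithin_comp_right hc hW.uniqueDiffOn
      hW'.uniqueDiffOn hmem le_rfl
    rw [iteratedFDerivWithin_of_isOpen j hW' hmem, iteratedFDerivWithin_of_isOpen j hW hmem,
      iteratedFDeriv_comp_add_right] at h
    have h1 : (fun z ↦ G (z + A)) ∘ ContinuousLinearMap.inr ℝ ℝ E = fun z ↦ G (p.1, z) := by
      funext z
      simp [hA]
    have h2 : ContinuousLinearMap.inr ℝ ℝ E p.2 + A = p := by simp [hA]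
    rw [h1, h2] at h
    exact h
  refine ContinuousAt.congr ?_ hev.symm
  exact (ContinuousLinearMap.continuous _).continuousAt.comp
    (hG.iteratedFDeriv_right (m := 0) (by simp)).continuousAt

end PartialDerivatives

/-! ### Dual homomorphisms -/

section Cocycles

/-- A linearly independent family of a group has a dual family of real homomorphisms. -/
theorem exists_dual_hom {A ι : Type*} [AddCommGroup A] [DecidableEq ι] {v : ι → A}
    (hv : LinearIndependent ℤ v) (i : ι) :
    ∃ c : A →+ ℝ, ∀ j, c (v j) = if j = i then 1 else 0 := by
  -- Divisibility of ℝ extends the dual functional from the span of the family to the whole group.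
  -- In the application this includes classes of paths that are not closed, on which the local
  -- potentials depend.
  obtain ⟨h, hh⟩ := (Module.Baer.of_divisible ℝ).extension_property
    (Finsupp.linearCombination ℤ v) hv
    (Finsupp.linearCombination ℤ fun j : ι ↦ if j = i then (1 : ℝ) else 0)
  refine ⟨h.toAddMonoidHom, fun j ↦ ?_⟩
  have := LinearMap.congr_fun hh (Finsupp.single j 1)
  simpa using this

end Cocycles

/-! ### Area-preserving flows and the C^r topology -/

section AreaFlows

variable {M : Type*} [TopologicalSpace M] [ChartedSpace Plane M] [IsManifold (𝓡 2) ∞ M]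

/-- A smooth flow that preserves the area form. -/
structure AreaFlow (Ω : AreaForm M) where
  toFun : ℝ → M → M
  map_zero (x : M) : toFun 0 x = x
  map_add (s t : ℝ) (x : M) : toFun (s + t) x = toFun s (toFun t x)
  smooth : SmoothFamily ∞ toFun
  pullback_eq (t : ℝ) (p : M) (v w : TangentSpace (𝓡 2) p) :
    Ω.toFun (toFun t p) (mfderiv (𝓡 2) (𝓡 2) (toFun t) p v)
      (mfderiv (𝓡 2) (𝓡 2) (toFun t) p w) = Ω.toFun p v w

namespace AreaFlow

variable {Ω : AreaForm M} (Φ : AreaFlow Ω)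

/-- The diffeomorphisms of a flow. -/
def diffeomorph (r : ℕ∞) (t : ℝ) : Diffeomorph (𝓡 2) (𝓡 2) M M r where
  toFun := Φ.toFun t
  invFun := Φ.toFun (-t)
  left_inv x := by rw [← Φ.map_add, neg_add_cancel, Φ.map_zero]
  right_inv x := by rw [← Φ.map_add, add_neg_cancel, Φ.map_zero]
  contMDiff_toFun := (Φ.smooth.contMDiff_apply t).of_le (by exact_mod_cast le_top)
  contMDiff_invFun := (Φ.smooth.contMDiff_apply (-t)).of_le (by exact_mod_cast le_top)

/-- The composition `φ_t ∘ f`. -/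
def comp {r : ℕ∞} (hr : 1 ≤ r) (f : AreaDiffeo Ω r) (t : ℝ) : AreaDiffeo Ω r :=
  ⟨f.1.trans (Φ.diffeomorph r t), fun x v w ↦ by
    have h1 : MDifferentiableAt (𝓡 2) (𝓡 2) (Φ.toFun t) (f.1 x) :=
      ((Φ.smooth.contMDiff_apply t) _).mdifferentiableAt (by simp)
    have h2 : MDifferentiableAt (𝓡 2) (𝓡 2) f.1 x :=
      (f.1.contMDiff x).mdifferentiableAt (by
        have : r ≠ 0 := (zero_lt_one.trans_le hr).ne'
        exact_mod_cast this)
    have h3 : ∀ a : TangentSpace (𝓡 2) x,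
        (mfderiv (𝓡 2) (𝓡 2) (f.1.trans (Φ.diffeomorph r t)) x : Plane →L[ℝ] Plane) a =
        (mfderiv (𝓡 2) (𝓡 2) (Φ.toFun t) (f.1 x) : Plane →L[ℝ] Plane)
          ((mfderiv (𝓡 2) (𝓡 2) f.1 x : Plane →L[ℝ] Plane) a) :=
      fun a ↦ congrArg (fun L : Plane →L[ℝ] Plane ↦ L a) (mfderiv_comp x h1 h2)
    refine (Ω.apply_congr rfl (h3 v) (h3 w)).trans ?_
    exact (Φ.pullback_eq t (f.1 x) _ _).trans (f.2 x v w)⟩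

variable {r : ℕ∞} (hr : 1 ≤ r) (f : AreaDiffeo Ω r)

theorem comp_apply (t : ℝ) (x : M) : (Φ.comp hr f t).1 x = Φ.toFun t (f.1 x) := rfl

theorem continuous_uncurry : Continuous fun p : ℝ × M ↦ Φ.toFun p.1 p.2 := Φ.smooth.continuous

theorem homotopic_comp (t : ℝ) :
    (Φ.comp hr f t).toContinuousMap.Homotopic f.toContinuousMap :=
  ⟨{ toFun := fun q ↦ Φ.toFun ((1 - q.1) * t) (f.1 q.2)
     continuous_toFun := Φ.continuous_uncurry.comp
      (f := fun q : unitInterval × M ↦ ((1 - (q.1 : ℝ)) * t, f.1 q.2))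
      ((by fun_prop : Continuous fun q : unitInterval × M ↦ (1 - (q.1 : ℝ)) * t).prodMk
        (f.1.continuous.comp continuous_snd))
     map_zero_left := fun x ↦ by simp; rfl
     map_one_left := fun x ↦ by simp [Φ.map_zero]; rfl }⟩

theorem contDiffAt_inCharts (f : AreaDiffeo Ω r) {x y p : M} (hp : p ∈ (chartAt Plane x).source)
    (hy : f.1 p ∈ (chartAt Plane y).source) :
    ContDiffAt ℝ r (fun q : ℝ × Plane ↦ chartAt Plane y
      (Φ.toFun q.1 (f.1 ((chartAt Plane x).symm q.2)))) (0, chartAt Plane x p) := by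
  set e := chartAt Plane x
  have hr' : (r : WithTop ℕ∞) ≤ (∞ : WithTop ℕ∞) := by exact_mod_cast le_top
  have h1 : ContMDiffAt 𝓘(ℝ, ℝ × Plane) (𝓡 2) r (fun q : ℝ × Plane ↦ f.1 (e.symm q.2))
      (0, e p) := by
    have h0 : ContMDiffAt 𝓘(ℝ, ℝ × Plane) (𝓡 2) r (fun q : ℝ × Plane ↦ e.symm q.2) (0, e p) :=
      ((contMDiffOn_chart_symm (I := 𝓡 2) (n := ∞) (x := x)).contMDiffAt
        (e.open_target.mem_nhds (e.map_source hp))).of_le hr' |>.comp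
          (f := fun q : ℝ × Plane ↦ q.2) (0, e p) contDiff_snd.contMDiff.contMDiffAt
    exact ContMDiffAt.comp (0, e p) (f.1.contMDiff (e.symm (e p))) h0
  have h2 : ContMDiffAt 𝓘(ℝ, ℝ × Plane) 𝓘(ℝ, ℝ) r (fun q : ℝ × Plane ↦ q.1) (0, e p) :=
    contDiff_fst.contMDiff.contMDiffAt
  have h3 : ContMDiffAt 𝓘(ℝ, ℝ × Plane) (𝓡 2) r
      (fun q : ℝ × Plane ↦ Φ.toFun q.1 (f.1 (e.symm q.2))) (0, e p) :=
    ((Φ.smooth (0, f.1 (e.symm (e p)))).of_le hr').comp (0, e p) (h2.prodMk h1)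
  have h4 : ContMDiffAt (𝓡 2) (𝓡 2) r (chartAt Plane y) (Φ.toFun 0 (f.1 (e.symm (e p)))) :=
    ((contMDiffOn_chart (I := 𝓡 2) (n := ∞) (x := y)).contMDiffAt
      ((chartAt Plane y).open_source.mem_nhds
        (by rw [Φ.map_zero, e.left_inv hp]; exact hy))).of_le hr'
  exact contMDiffAt_iff_contDiffAt.1 (ContMDiffAt.comp (0, e p) h4 h3)

/-- `φ_t ∘ f` tends to `f` in the `C^r` topology. -/
theorem tendsto_comp : Filter.Tendsto (Φ.comp hr f) (𝓝 0) (𝓝 f) := by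
  rw [TopologicalSpace.tendsto_nhds_generateFrom_iff]
  -- A subbasic set that contains f may be centred at another map f₀. Its conditions are open in (t,
  -- p) near (0, p), and compactness of K makes them hold for all small t at once.
  rintro _ ⟨f₀, x, y, K, k, ε, hK, hKx, hf₀, hk, hε, rfl⟩ ⟨hmaps, hclose⟩
  set e := chartAt Plane x with he
  have hmem : ∀ p ∈ K, ∀ᶠ q : ℝ × M in 𝓝 (0, p),
      Φ.toFun q.1 (f.1 q.2) ∈ (chartAt Plane y).source := by
    intro p hp
    have hc : Continuous fun q : ℝ × M ↦ Φ.toFun q.1 (f.1 q.2) :=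
      Φ.continuous_uncurry.comp (f := fun q : ℝ × M ↦ (q.1, f.1 q.2))
        (continuous_fst.prodMk (f.1.continuous.comp continuous_snd))
    refine hc.continuousAt.eventually ((chartAt Plane y).open_source.mem_nhds ?_)
    simp only [Φ.map_zero]
    exact hmaps hp
  have hder : ∀ p ∈ K, ∀ᶠ q : ℝ × M in 𝓝 (0, p), ∀ j ≤ k,
      ‖iteratedFDeriv ℝ j (inCharts (Φ.comp hr f q.1) x y) (e q.2) -
        iteratedFDeriv ℝ j (inCharts f₀ x y) (e q.2)‖ < ε := by
    intro p hp
    have hpx := hKx hp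
    have hall : ∀ j ∈ Finset.range (k + 1), ∀ᶠ q : ℝ × M in 𝓝 (0, p),
        ‖iteratedFDeriv ℝ j (inCharts (Φ.comp hr f q.1) x y) (e q.2) -
          iteratedFDeriv ℝ j (inCharts f₀ x y) (e q.2)‖ < ε := by
      intro j hj
      have hjk : j ≤ k := Nat.lt_succ_iff.1 (Finset.mem_range.1 hj)
      have hjr : ((j : ℕ) : WithTop ℕ∞) ≤ (r : WithTop ℕ∞) := by
        have : (j : ℕ∞) ≤ r := le_trans (by exact_mod_cast hjk) hk
        exact_mod_cast this
      have h1 := continuousAt_iteratedFDeriv_partial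
        ((Φ.contDiffAt_inCharts f hpx (hmaps hp)).of_le hjr)
      have h2 : ContDiffAt ℝ j (inCharts f₀ x y) (e p) := by
        have h3 : ContMDiffAt (𝓡 2) (𝓡 2) r (f₀.1 ∘ e.symm) (e p) :=
          (f₀.1.contMDiff _).comp _ ((contMDiffOn_chart_symm (I := 𝓡 2) (n := ∞)
            (x := x)).contMDiffAt (e.open_target.mem_nhds (e.map_source hpx)) |>.of_le
            (by exact_mod_cast le_top))
        have h4 : ContMDiffAt (𝓡 2) (𝓡 2) r (chartAt Plane y) ((f₀.1 ∘ e.symm) (e p)) :=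
          ((contMDiffOn_chart (I := 𝓡 2) (n := ∞) (x := y)).contMDiffAt
            ((chartAt Plane y).open_source.mem_nhds
              (by rw [Function.comp, e.left_inv hpx]; exact hf₀ hp))).of_le
            (by exact_mod_cast le_top)
        exact (contMDiffAt_iff_contDiffAt.1 (ContMDiffAt.comp (e p) h4 h3)).of_le hjr
      have h5 : ContinuousAt (iteratedFDeriv ℝ j (inCharts f₀ x y)) (e p) :=
        (h2.iteratedFDeriv_right (m := 0) (by simp)).continuousAt
      have h6 : ContinuousAt (fun q : ℝ × M ↦ (q.1, e q.2)) (0, p) :=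
        continuousAt_fst.prodMk ((e.continuousAt hpx).comp continuousAt_snd)
      have h7 : ContinuousAt (fun q : ℝ × M ↦
          ‖iteratedFDeriv ℝ j (inCharts (Φ.comp hr f q.1) x y) (e q.2) -
            iteratedFDeriv ℝ j (inCharts f₀ x y) (e q.2)‖) (0, p) :=
        ((h1.comp (f := fun q : ℝ × M ↦ (q.1, e q.2)) h6).sub
          (h5.comp (f := fun q : ℝ × M ↦ e q.2) ((e.continuousAt hpx).comp continuousAt_snd))).norm
      refine h7.eventually (gt_mem_nhds ?_)
      have h8 : inCharts (Φ.comp hr f 0) x y = inCharts f x y := by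
        funext z
        simp only [inCharts, Function.comp, comp_apply, Φ.map_zero]
      simp only [h8]
      exact hclose p hp j hjk
    filter_upwards [(Filter.eventually_all_finset _).2 hall] with q hq j hj
    exact hq j (Finset.mem_range.2 (Nat.lt_succ_iff.2 hj))
  filter_upwards [hK.eventually_forall_of_forall_eventually
      (P := fun t p ↦ Φ.toFun t (f.1 p) ∈ (chartAt Plane y).source) hmem,
    hK.eventually_forall_of_forall_eventually (P := fun t p ↦ ∀ j ≤ k,
      ‖iteratedFDeriv ℝ j (inCharts (Φ.comp hr f t) x y) (e p) -
        iteratedFDeriv ℝ j (inCharts f₀ x y) (e p)‖ < ε) hder] with t h1 h2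
  exact ⟨h1, h2⟩

end AreaFlow

end AreaFlows

/-! ### Fluxes and their successive correction -/

section FluxNumbers

variable {M : Type*} [TopologicalSpace M] [ChartedSpace Plane M]

/-- A closed curve as a map on the real line, constant outside `[0,1]`. -/
def ClosedCurve.extend (l : ClosedCurve M) : ℝ → M :=
  Set.IccExtend zero_le_one l.toFun

theorem ClosedCurve.extend_coe (l : ClosedCurve M) (t : unitInterval) : l.extend t = l.toFun t :=
  Set.IccExtend_val _ _ t

theorem ClosedCurve.continuous_extend (l : ClosedCurve M) : Continuous l.extend :=
  l.contMDiff.continuous.Icc_extend'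

theorem ClosedCurve.extend_zero (l : ClosedCurve M) : l.extend 0 = l.extend 1 :=
  (l.extend_coe 0).trans (l.closed.trans (l.extend_coe 1).symm)

theorem ClosedCurve.contMDiffOn_extend (l : ClosedCurve M) :
    ContMDiffOn 𝓘(ℝ, ℝ) (𝓡 2) 1 l.extend (Set.Icc 0 1) := by
  have : Fact ((0 : ℝ) < 1) := ⟨zero_lt_one⟩
  exact contMDiffOn_comp_projIcc_iff.2 l.contMDiff

variable [IsManifold (𝓡 2) ∞ M]

/-- `s` is the area of a 2-chain that bounds `f(l) - l`. -/
def HasFlux (Ω : AreaForm M) (f : M → M) (l : ClosedCurve M) (s : ℝ) : Prop :=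
  ∃ D ∈ smoothChain₂ M,
    boundary₂ M D = Finsupp.single (f ∘ l.toFun) 1 - Finsupp.single l.toFun 1 ∧
    chainIntegral Ω D = s

theorem HasFlux.isFlux {Ω : AreaForm M} {f : M → M} {l : ClosedCurve M} {s : ℝ}
    (h : HasFlux Ω f l s) : IsFlux Ω f l s := by
  obtain ⟨D, hD, hb, rfl⟩ := h
  exact ⟨D, hD, hb, rfl⟩

/-- The bounding chain itself witnesses the homology, so a cocycle takes the same value on f(l) as
on l. -/
theorem HasFlux.pathClass_eq {Ω : AreaForm M} {f : M → M} {l : ClosedCurve M} {s : ℝ}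
    (h : HasFlux Ω f l s) : pathClass (f ∘ l.toFun) = l.homologyClass := by
  obtain ⟨D, hD, hb, -⟩ := h
  have := mkQ_boundary₂ hD
  rw [hb, map_sub, sub_eq_zero] at this
  exact this

/-- A map that is homotopic to the identity has a flux. -/
theorem exists_hasFlux (Ω : AreaForm M) {f : C(M, M)} (hf : f.Homotopic (ContinuousMap.id M))
    (hf1 : ContMDiff (𝓡 2) (𝓡 2) 1 f) (l : ClosedCurve M) : ∃ s, HasFlux Ω f l s := by
  obtain ⟨H⟩ := hf
  have h := pathClass_eq_of_homotopic
    (K := fun q : ℝ × ℝ ↦ H (Set.projIcc 0 1 zero_le_one q.2, l.extend q.1))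
    (H.continuous.comp ((continuous_projIcc.comp continuous_snd).prodMk
      (l.continuous_extend.comp continuous_fst)))
    (fun t _ ↦ by simp only [l.extend_zero])
    (by
      simp only [Set.projIcc_left]
      exact (hf1.comp_contMDiffOn l.contMDiffOn_extend).congr fun s _ ↦ H.apply_zero _)
    (by
      simp only [Set.projIcc_right]
      exact l.contMDiffOn_extend.congr fun s _ ↦ H.apply_one _)
  simp only [Set.projIcc_left, Set.projIcc_right, l.extend_coe] at h
  have e0 : (fun t : unitInterval ↦ H (0, l.toFun t)) = f ∘ l.toFun :=
    funext fun t ↦ H.apply_zero _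
  have e1 : (fun t : unitInterval ↦ H (1, l.toFun t)) = l.toFun := funext fun t ↦ H.apply_one _
  have h' : pathClass (f ∘ l.toFun) = pathClass l.toFun := by
    rw [← e0]; exact h.trans (congrArg pathClass e1)
  have hmem : Finsupp.single (f ∘ l.toFun) (1 : ℤ) - Finsupp.single l.toFun 1 ∈
      boundaries₁ M := (Submodule.Quotient.eq _).1 h'
  obtain ⟨D, hD, hb⟩ := hmem
  exact ⟨_, D, hD, hb, rfl⟩

/-- Every real homomorphism on homology is the flux of a smooth flow that preserves the area. -/
theorem exists_areaFlow [T2Space M] [CompactSpace M] (Ω : AreaForm M) (c : ChainClass M →+ ℝ) :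
    ∃ Φ : AreaFlow Ω, ∀ γ : ℝ → M, ContMDiffOn 𝓘(ℝ, ℝ) (𝓡 2) 1 γ (Set.Icc 0 1) → γ 0 = γ 1 →
      ∀ T : ℝ, chainIntegral Ω (squareChain fun q ↦ Φ.toFun (T * q.2) (γ q.1)) =
        T * c (pathClass fun t : unitInterval ↦ γ t) := by
  obtain ⟨u⟩ := nonempty_smoothPotential c
  obtain ⟨φ, h0, hadd, hint, hφ⟩ := exists_flow (u.contMDiff_field Ω)
  exact ⟨⟨φ, h0, hadd, hφ, pullback_flow_eq u Ω h0 hadd hφ hint⟩,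
    fun γ hγ hγ01 T ↦ chainIntegral_sweep u Ω h0 hadd hφ hint hγ hγ01 T⟩

/-- The cylinder swept by f(l) is added to a chain bounding f(l) - l. The two sides of the cut
cylinder cancel because the curve is closed. -/
theorem HasFlux.comp {Ω : AreaForm M} {c : ChainClass M →+ ℝ} {Φ : AreaFlow Ω}
    (hΦ : ∀ γ : ℝ → M, ContMDiffOn 𝓘(ℝ, ℝ) (𝓡 2) 1 γ (Set.Icc 0 1) → γ 0 = γ 1 →
      ∀ T : ℝ, chainIntegral Ω (squareChain fun q ↦ Φ.toFun (T * q.2) (γ q.1)) =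
        T * c (pathClass fun t : unitInterval ↦ γ t))
    {f : M → M} (hf1 : ContMDiff (𝓡 2) (𝓡 2) 1 f) {l : ClosedCurve M} {s : ℝ}
    (h : HasFlux Ω f l s) (T : ℝ) :
    HasFlux Ω (Φ.toFun T ∘ f) l (s + T * c l.homologyClass) := by
  have hcls := h.pathClass_eq
  obtain ⟨D, hD, hb, rfl⟩ := h
  have hγ : ContMDiffOn 𝓘(ℝ, ℝ) (𝓡 2) 1 (f ∘ l.extend) (Set.Icc 0 1) :=
    hf1.comp_contMDiffOn l.contMDiffOn_extend
  have hγ01 : (f ∘ l.extend) 0 = (f ∘ l.extend) 1 := congrArg f l.extend_zero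
  have hγl : (fun t : unitInterval ↦ (f ∘ l.extend) t) = f ∘ l.toFun :=
    funext fun t ↦ congrArg f (l.extend_coe t)
  refine ⟨D + squareChain fun q ↦ Φ.toFun (T * q.2) ((f ∘ l.extend) q.1),
    Submodule.add_mem _ hD (squareChain_mem_smoothChain₂ (Φ.smooth.contMDiffOn_sweep hγ T)), ?_, ?_⟩
  · rw [map_add, hb, boundary₂_squareChain]
    have e0 : (fun t : unitInterval ↦ Φ.toFun (T * 0) ((f ∘ l.extend) t)) = f ∘ l.toFun := by
      rw [← hγl]
      funext t
      rw [mul_zero, Φ.map_zero]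
    have e1 : (fun t : unitInterval ↦ Φ.toFun (T * 1) ((f ∘ l.extend) t)) =
        (Φ.toFun T ∘ f) ∘ l.toFun := by
      rw [mul_one, Function.comp_assoc, ← hγl]
      rfl
    simp only [hγ01, e0, e1]
    abel
  · rw [chainIntegral_add, hΦ _ hγ hγ01, hγl, hcls]

/-- Induction over the curves already corrected: the flow for the dual functional of curve i leaves
every other flux unchanged, and openness of V leaves room for another small step. Real lifts of the
fluxes are carried along. -/
theorem exists_hasFlux_rational [T2Space M] [CompactSpace M] {Ω : AreaForm M} {r : ℕ∞}
    (hr : 1 ≤ r) {ι : Type*} [DecidableEq ι] {l : ι → ClosedCurve M}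
    (hl : LinearIndependent ℤ fun i ↦ (l i).homologyClass) {f : AreaDiffeo Ω r}
    (hf : f.toContinuousMap.Homotopic (ContinuousMap.id M)) {V : Set (AreaDiffeo Ω r)}
    (hV : IsOpen V) (hfV : f ∈ V) (S : Finset ι) :
    ∃ h ∈ V, h.toContinuousMap.Homotopic (ContinuousMap.id M) ∧
      ∃ s : ι → ℝ, (∀ i, HasFlux Ω h.1 (l i) (s i)) ∧ ∀ i ∈ S, ∃ q : ℚ, s i = q := by
  have hC1 : ∀ h : AreaDiffeo Ω r, ContMDiff (𝓡 2) (𝓡 2) 1 h.1 := fun h ↦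
    h.1.contMDiff.of_le (by exact_mod_cast hr)
  induction S using Finset.induction_on with
  | empty =>
    choose s hs using fun i ↦ exists_hasFlux Ω hf (hC1 f) (l i)
    exact ⟨f, hfV, hf, s, hs, by simp⟩
  | insert i S hi ih =>
    obtain ⟨h, hhV, hh, s, hs, hS⟩ := ih
    obtain ⟨c, hc⟩ := exists_dual_hom hl i
    obtain ⟨Φ, hΦ⟩ := exists_areaFlow Ω c
    have hev := (Φ.tendsto_comp hr h).eventually (hV.mem_nhds hhV)
    obtain ⟨ε, hε, hball⟩ := Metric.eventually_nhds_iff.1 hev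
    -- Flowing for time q - s i, which is less than ε, moves the i-th flux exactly to q.
    obtain ⟨q, hq1, hq2⟩ := exists_rat_btwn (lt_add_of_pos_right (s i) hε)
    refine ⟨Φ.comp hr h (q - s i), hball ?_, (Φ.homotopic_comp hr h _).trans hh,
      fun j ↦ s j + (q - s i) * c (l j).homologyClass,
      fun j ↦ (hs j).comp hΦ (hC1 h) (q - s i), fun j hj ↦ ?_⟩
    · rw [Real.dist_eq, sub_zero, abs_lt]
      constructor <;> linarith
    · simp only [hc]
      by_cases hji : j = i
      · exact ⟨q, by simp [hji]⟩
      · obtain ⟨q', hq'⟩ := hS j (Finset.mem_of_mem_insert_of_ne hj hji)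
        exact ⟨q', by simp [hji, hq']⟩

end FluxNumbers

end SurfaceFlux

end

theorem mainTheorem7 {M : Type*} [TopologicalSpace M] [T2Space M] [CompactSpace M]
    [ConnectedSpace M] [ChartedSpace SurfaceFlux.Plane M] [IsManifold (𝓡 2) ∞ M]
    (Ω : SurfaceFlux.AreaForm M) (hΩ : SurfaceFlux.totalArea Ω = 1)
    (g : ℕ) (a b : Fin g → SurfaceFlux.ClosedCurve M)
    (hab : SurfaceFlux.IsHomologyBasis (Sum.elim a b))
    (r : ℕ∞) (hr : 1 ≤ r)
    (f : SurfaceFlux.AreaDiffeo Ω r)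
    (hf : f.toContinuousMap.Homotopic (ContinuousMap.id M))
    (V : Set (SurfaceFlux.AreaDiffeo Ω r)) (hV : V ∈ 𝓝 f) :
    ∃ h ∈ V, h.toContinuousMap.Homotopic (ContinuousMap.id M) ∧
      ∃ v : Fin g ⊕ Fin g → UnitAddCircle,
        SurfaceFlux.IsFluxVector Ω h.1 (Sum.elim a b) v ∧ SurfaceFlux.IsRationalVector v := by
  obtain ⟨W, hWV, hW, hfW⟩ := mem_nhds_iff.1 hV
  obtain ⟨h, hhW, hh, s, hs, hrat⟩ :=
    SurfaceFlux.exists_hasFlux_rational hr hab.1 hf hW hfW Finset.univ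
  refine ⟨h, hWV hhW, hh, fun i ↦ s i, fun i ↦ (hs i).isFlux, fun i ↦ ?_⟩
  obtain ⟨q, hq⟩ := hrat i (Finset.mem_univ i)
  exact ⟨q, congrArg _ hq⟩
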